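/- **Conventions.** A generic front of an oriented Legendrian link $l$ in $(\mathbb R^3,\ker(du-p\,dq))$ is a plane curve in the $(q,u)$-plane, without vertical tangents, with transverse double points and with cusps pointing leftward or rightward; it is considered up to the combinatorial type of such pictures. Its *morsification* is the link diagram in which at each crossing the branch of larger slope passes over, each left cusp is rounded, and each right cusp is replaced by a positive curl (writhe $+1$). If $w$ denotes the writhe, $tb(l)=-w(\text{morsification})$. $R$ is the regular isotopy invariant of oriented link diagrams, with values in $\mathbb Z[z^{\pm1},a^{\pm1}]$, determined by: the circle has value $\frac{a-a^{-1}}{z}$ (and the empty diagram has value $1$); $R(K_+)-R(K_-)=z\,R(K_0)$, where $K_+,K_-,K_0$ differ only near one crossing, which is positive, negative, and smoothed according to the orientation; adding a curl of sign $\pm1$ multiplies $R$ by $a^{\pm1}$. $D$ is the regular isotopy invariant of unoriented link diagrams determined by: the circle has value $\frac{a-a^{-1}}{z}+1$ (and the empty diagram $1$); $D(K_1)-D(K_2)=z\,(D(K_V)-D(K_H))$, where the four diagrams differ only near one crossing, at which in $K_1$ the branch of positive slope is over, in $K_2$ the branch of negative slope is over, in $K_V$ the crossing is replaced by two arcs $)\,($,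 and in $K_H$ by two horizontal arcs, one above the other; adding a curl of sign $\pm1$ multiplies $D$ by $a^{\pm1}$. The Kauffman polynomial is $Y=a^{-w}D$. For a front, $R(l)$, $D(l)$, $Y(l)$ are the values on its morsification, and $e_Y(l)$ is the least exponent of $a$ in $Y(l)$. A *state* $\sigma$ of the (unoriented) front of $l$ is an oriented front $l_\sigma$ obtained by keeping each crossing, or splicing it horizontally (into two horizontal strands, one above the other), or splicing it vertically (into a right cusp followed by a left cusp), and then choosing an orientation. Its weight $[l,\sigma]$ is the product over the crossings of local weights: $1$ for a kept crossing; $ta^{-2}(t-t^{-1})$ for a vertical splicing whose new right cusp is oriented downward and whose new left cusp is oriented upward; $t^{-1}-t$ for a horizontal splicing whose lower strand runs leftward and whose upper strand runs rightward; $0$ otherwise. Let $c(\sigma)$ be the number of left cusps of $l_\sigma$ oriented upward plus the number of right cusps of $l_\sigma$ oriented downward. The contribution of $\sigma$ (to the right side of the Legendrian Jaeger formula for $D(l)(t-t^{-1},a^2t^{-1})$) is $$(at^{-1})^{c(\sigma)}\,[l,\sigma]\,R(l_\sigma)(t-t^{-1},a),$$ a Laurent polynomial in $a$ with coefficients in $\mathbb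 Q(t)$. **Statement.** Let $l$ be an oriented Legendrian link (in particular, a Legendrian knot) given by a generic front. Then 1. for every state $\sigma$ of the front of $l$, the contribution of $\sigma$ is a genuine polynomial in $a$, that is, it contains no negative power of $a$; 2. $D(l)$ is a genuine polynomial in $a$, that is, it contains no negative power of $a$; 3. $tb(l)\le e_Y(l)$. -/

import Mathlib

open scoped LaurentPolynomial

noncomputable section

/-! ### Sliced plane diagrams

Diagrams are read from left to right and cut by vertical lines into elementary pieces.  A generic
vertical line meets the diagram in finitely many strands, listed from bottom to top. -/

/-- Labels carried by strands.  `Bool` is used for oriented diagrams (`true`: the strand runs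
rightward, `false`: leftward), `Unit` for unoriented ones.  `rev` reverses the direction. -/
class Direction (α : Type) where
  rev : α → α
  rev_rev : ∀ x, rev (rev x) = x

instance : Direction Bool := ⟨Bool.not, Bool.not_not⟩

instance : Direction Unit := ⟨id, fun _ => rfl⟩

open Direction

/-- The elementary pieces.
* `birth o`: a turn (or a cusp) pointing leftward, at which two neighbouring strands begin, the
  lower one with label `o`, the upper one with label `rev o`;
* `death`: a turn (or a cusp) pointing rightward, at which two neighbouring strands end;
* `cross c`: two neighbouring strands cross; `c` tells which one is over, if that is recorded. -/
inductive Piece (κ α : Type) : Type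
  | birth (o : α)
  | death
  | cross (c : κ)

/-- A sliced diagram, as the list from left to right of its pieces; each piece comes with the number
of strands that pass below it. -/
abbrev Word (κ α : Type) := List (ℕ × Piece κ α)

/-- Effect of a piece on the strands, when it sits at the bottom. -/
def Piece.act {κ α : Type} [DecidableEq α] [Direction α] : Piece κ α → List α → Option (List α)
  | .birth o, s => some (o :: rev o :: s)
  | .death, x :: y :: s => if y = rev x then some s else none
  | .cross _, x :: y :: s => some (y :: x :: s)
  | _, _ => none

/-- Effect of a piece that has `k` strands below it. -/
def Piece.actAt {κ α : Type} [DecidableEq α] [Direction α] (p : Piece κ α) :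
    ℕ → List α → Option (List α)
  | 0, s => p.act s
  | _ + 1, [] => none
  | k + 1, x :: s => (p.actAt k s).map (x :: ·)

/-- The strands to the right of the word, given the strands to its left (`none` if the pieces do not
fit together). -/
def Word.run {κ α : Type} [DecidableEq α] [Direction α] : Word κ α → List α → Option (List α)
  | [], s => some s
  | (k, p) :: w, s => (p.actAt k s).bind (Word.run w)

/-- A closed sliced diagram: it starts and ends with no strand. -/
def ClosedWord (κ α : Type) [DecidableEq α] [Direction α] : Type :=
  {w : Word κ α // Word.run w [] = some []}

/-- Link diagrams: regular projections with over/under information.  A crossing has type `true` when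
the strand of positive slope (joining the lower left end to the upper right end) is over, and type
`false` when the strand of negative slope is over.  `LinkDiagram Bool` are the oriented diagrams,
`LinkDiagram Unit` the unoriented ones. -/
abbrev LinkDiagram (α : Type) [DecidableEq α] [Direction α] := ClosedWord Bool α

/-- Generic fronts of Legendrian links in the plane with horizontal coordinate `q` and vertical
coordinate `u`: `birth` is a cusp pointing leftward, `death` a cusp pointing rightward, and crossings
carry no information.  `Front Bool` are the oriented fronts, `Front Unit` the unoriented ones. -/
abbrev Front (α : Type) [DecidableEq α] [Direction α] := ClosedWord Unit α

/-! ### Regular isotopy -/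

def Piece.ins {κ α : Type} : Piece κ α → ℕ
  | .birth _ => 0
  | .death => 2
  | .cross _ => 2

def Piece.outs {κ α : Type} : Piece κ α → ℕ
  | .birth _ => 2
  | .death => 0
  | .cross _ => 2

/-- The local moves that generate regular isotopy of sliced diagrams: the first five come from
isotopies of the plane, the last two are the second and the third Reidemeister moves. -/
inductive LocalMove {α : Type} : Word Bool α → Word Bool α → Prop
  | far (e f : Piece Bool α) (k m : ℕ) :
      LocalMove [(k, e), (k + e.outs + m, f)] [(k + e.ins + m, f), (k, e)]
  | zigzag (k : ℕ) (o : α) : LocalMove [(k, .birth o), (k + 1, .death)] []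
  | zagzig (k : ℕ) (o : α) : LocalMove [(k + 1, .birth o), (k, .death)] []
  | slideBirth (k : ℕ) (o : α) (c : Bool) :
      LocalMove [(k, .birth o), (k + 1, .cross c)] [(k + 1, .birth o), (k, .cross !c)]
  | slideDeath (k : ℕ) (c : Bool) :
      LocalMove [(k + 1, .cross c), (k, .death)] [(k, .cross !c), (k + 1, .death)]
  | reidemeister2 (k : ℕ) (c : Bool) : LocalMove [(k, .cross c), (k, .cross !c)] []
  | reidemeister3 (k : ℕ) (c : Bool) :
      LocalMove [(k, .cross c), (k + 1, .cross c), (k, .cross c)]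
        [(k + 1, .cross c), (k, .cross c), (k + 1, .cross c)]

/-- Regular isotopy of diagrams (the first Reidemeister move is not allowed). -/
def RegularIsotopic {α : Type} [DecidableEq α] [Direction α] :
    LinkDiagram α → LinkDiagram α → Prop :=
  Relation.EqvGen fun K L => ∃ u v x y, LocalMove x y ∧ K.1 = u ++ x ++ v ∧ L.1 = u ++ y ++ v

/-! ### The polynomials `R` and `D`

Laurent polynomials in `a` with coefficients in `ℤ[z, z⁻¹]`. -/

abbrev Laurent2 := (ℤ[T;T⁻¹])[T;T⁻¹]

/-- `aPow n = a ^ n`. -/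
def aPow (n : ℤ) : Laurent2 := LaurentPolynomial.T n

/-- `zPow n = z ^ n`. -/
def zPow (n : ℤ) : Laurent2 := LaurentPolynomial.C (LaurentPolynomial.T n)

/-- `Kink c x`: `x` is a horizontal strand at height `k` with a small curl, above or below the strand.
In both cases the two branches at the crossing run rightward or both leftward, so that the curl is
positive for `c = false` and negative for `c = true`. -/
inductive Kink {α : Type} (c : Bool) : Word Bool α → Prop
  | above (k : ℕ) (o : α) : Kink c [(k + 1, .birth o), (k, .cross c), (k + 1, .death)]
  | below (k : ℕ) (o : α) : Kink c [(k, .birth o), (k + 1, .cross c), (k, .death)]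

/-- Oriented words that agree except near a crossing, which is positive in the first one, negative
in the second one, and smoothed according to the orientation in the third one. -/
inductive SkeinTriple : Word Bool Bool → Word Bool Bool → Word Bool Bool → Prop
  | parallel (u v : Word Bool Bool) (p t : List Bool) (x : Bool)
      (h : Word.run u [] = some (p ++ x :: x :: t)) :
      SkeinTriple (u ++ [(p.length, .cross false)] ++ v) (u ++ [(p.length, .cross true)] ++ v)
        (u ++ v)
  | antiparallel (u v : Word Bool Bool) (p t : List Bool) (x : Bool)
      (h : Word.run u [] = some (p ++ x :: (!x) :: t)) :
      SkeinTriple (u ++ [(p.length, .cross true)] ++ v) (u ++ [(p.length, .cross false)] ++ v)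
        (u ++ [(p.length, .death), (p.length, .birth (!x))] ++ v)

/-- The defining properties of the regular isotopy invariant `R` of oriented diagrams. -/
structure IsHomflyR (R : LinkDiagram Bool → Laurent2) : Prop where
  regular : ∀ K L, RegularIsotopic K L → R K = R L
  empty : ∀ K : LinkDiagram Bool, K.1 = [] → R K = 1
  circle : ∀ (K : LinkDiagram Bool) (o : Bool), K.1 = [(0, .birth o), (0, .death)] →
    R K = (aPow 1 - aPow (-1)) * zPow (-1)
  skein : ∀ K₁ K₂ K₀ : LinkDiagram Bool, SkeinTriple K₁.1 K₂.1 K₀.1 →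
    R K₁ - R K₂ = zPow 1 * R K₀
  kink : ∀ (K L : LinkDiagram Bool) (c : Bool) (u x v : Word Bool Bool), Kink c x →
    K.1 = u ++ x ++ v → L.1 = u ++ v → R K = aPow (if c then -1 else 1) * R L

/-- The defining properties of the regular isotopy invariant `D` of unoriented diagrams. -/
structure IsKauffmanD (D : LinkDiagram Unit → Laurent2) : Prop where
  regular : ∀ K L, RegularIsotopic K L → D K = D L
  empty : ∀ K : LinkDiagram Unit, K.1 = [] → D K = 1
  circle : ∀ K : LinkDiagram Unit, K.1 = [(0, .birth ()), (0, .death)] →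
    D K = (aPow 1 - aPow (-1)) * zPow (-1) + 1
  skein : ∀ (K₁ K₂ KV KH : LinkDiagram Unit) (u v : Word Bool Unit) (k : ℕ),
    K₁.1 = u ++ [(k, .cross true)] ++ v → K₂.1 = u ++ [(k, .cross false)] ++ v →
    KV.1 = u ++ [(k, .death), (k, .birth ())] ++ v → KH.1 = u ++ v →
    D K₁ - D K₂ = zPow 1 * (D KV - D KH)
  kink : ∀ (K L : LinkDiagram Unit) (c : Bool) (u x v : Word Bool Unit), Kink c x →
    K.1 = u ++ x ++ v → L.1 = u ++ v → D K = aPow (if c then -1 else 1) * D L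

open Classical in
/-- The invariant `R` determined by its skein relations. -/
def homflyR : LinkDiagram Bool → Laurent2 :=
  if h : ∃ R, IsHomflyR R then h.choose else 0

open Classical in
/-- The invariant `D` determined by its skein relations. -/
def kauffmanD : LinkDiagram Unit → Laurent2 :=
  if h : ∃ D, IsKauffmanD D then h.choose else 0

/-! ### Forgetting orientations, morsification -/

def Piece.forget {κ α : Type} : Piece κ α → Piece κ Unit
  | .birth _ => .birth ()
  | .death => .death
  | .cross c => .cross c

def Word.forget {κ α : Type} (w : Word κ α) : Word κ Unit := w.map fun e => (e.1, e.2.forget)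

theorem Piece.forget_actAt {κ α : Type} [DecidableEq α] [Direction α] (p : Piece κ α) (k : ℕ)
    (s s' : List α) (h : p.actAt k s = some s') :
    p.forget.actAt k (s.map fun _ => ()) = some (s'.map fun _ => ()) := by
  induction k generalizing s s' with
  | zero =>
    rcases p with o | _ | c <;> rcases s with _ | ⟨x, _ | ⟨y, s⟩⟩ <;>
      simp_all [Piece.actAt, Piece.act, Piece.forget] <;>
      (obtain ⟨_, rfl⟩ := h; rfl)
  | succ k ih =>
    rcases s with _ | ⟨x, s⟩
    · simp [Piece.actAt] at h
    · simp only [Piece.actAt, Option.map_eq_some_iff] at h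
      obtain ⟨r, hr, rfl⟩ := h
      have := ih s r hr
      simp only [List.map_cons, Piece.actAt, this, Option.map_some]

theorem Word.forget_run {κ α : Type} [DecidableEq α] [Direction α] (w : Word κ α)
    (s s' : List α) (h : Word.run w s = some s') :
    Word.run w.forget (s.map fun _ => ()) = some (s'.map fun _ => ()) := by
  induction w generalizing s with
  | nil => simp_all [Word.run, Word.forget]
  | cons e w ih =>
    obtain ⟨k, p⟩ := e
    simp only [Word.run, Option.bind_eq_some_iff] at h
    obtain ⟨r, hr, hw⟩ := h
    have := ih r hw
    simp only [Word.forget] at this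
    simp only [Word.run, Word.forget, List.map_cons, p.forget_actAt k s r hr, Option.bind_some, this]

/-- The diagram or front with its orientation forgotten. -/
def ClosedWord.forget {κ α : Type} [DecidableEq α] [Direction α] (K : ClosedWord κ α) :
    ClosedWord κ Unit :=
  ⟨K.1.forget, Word.forget_run K.1 [] [] K.2⟩

/-- At crossings the strand of positive slope goes over, left cusps are rounded, and right cusps are
replaced by a positive curl. -/
def Piece.morsify {α : Type} (k : ℕ) : Piece Unit α → Word Bool α
  | .birth o => [(k, .birth o)]
  | .death => [(k, .cross true), (k, .death)]
  | .cross _ => [(k, .cross true)]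

def Word.morsify {α : Type} (w : Word Unit α) : Word Bool α := w.flatMap fun e => e.2.morsify e.1

theorem Word.run_append {κ α : Type} [DecidableEq α] [Direction α] (w w' : Word κ α)
    (s : List α) : Word.run (w ++ w') s = (Word.run w s).bind (Word.run w') := by
  induction w generalizing s with
  | nil => rfl
  | cons e w ih =>
    obtain ⟨k, p⟩ := e
    simp only [List.cons_append, Word.run, Option.bind_assoc]
    congr 1
    funext r
    exact ih r

theorem Piece.morsify_run {α : Type} [DecidableEq α] [Direction α] (p : Piece Unit α) (k : ℕ)
    (s s' : List α) (h : p.actAt k s = some s') : Word.run (p.morsify k) s = some s' := by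
  induction k generalizing s s' with
  | zero =>
    rcases p with o | _ | c <;> rcases s with _ | ⟨x, _ | ⟨y, s⟩⟩ <;>
      simp_all [Piece.actAt, Piece.act, Piece.morsify, Word.run, rev_rev]
  | succ k ih =>
    rcases s with _ | ⟨x, s⟩
    · simp [Piece.actAt] at h
    · simp only [Piece.actAt, Option.map_eq_some_iff] at h
      obtain ⟨r, hr, rfl⟩ := h
      have := ih s r hr
      rcases p with o | _ | c <;>
        simp [Piece.morsify, Word.run, Piece.actAt, Option.bind_eq_some_iff] at this ⊢ <;>
        exact this

theorem Word.morsify_run {α : Type} [DecidableEq α] [Direction α] (w : Word Unit α)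
    (s s' : List α) (h : Word.run w s = some s') : Word.run w.morsify s = some s' := by
  induction w generalizing s with
  | nil => simpa [Word.run, Word.morsify] using h
  | cons e w ih =>
    obtain ⟨k, p⟩ := e
    simp only [Word.run, Option.bind_eq_some_iff] at h
    obtain ⟨r, hr, hw⟩ := h
    have := ih r hw
    simp only [Word.morsify] at this
    simp [Word.morsify, Word.run_append, p.morsify_run k s r hr, this]

/-- The morsification of a front. -/
def Front.morsify {α : Type} [DecidableEq α] [Direction α] (l : Front α) : LinkDiagram α :=
  ⟨Word.morsify l.1, Word.morsify_run l.1 [] [] l.2⟩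

/-! ### Writhe, Bennequin invariant, `e_Y` -/

/-- Sign of a crossing; `s` lists the strands just left of the piece, from its height upward.  A
crossing of type `true` is positive exactly when one branch runs rightward and the other one
leftward. -/
def Piece.sign : Piece Bool Bool → List Bool → ℤ
  | .cross c, x :: y :: _ => if c = (x != y) then 1 else -1
  | _, _ => 0

/-- Sum of the signs of the crossings, when `s` lists the strands to the left of the word. -/
def Word.signSum : Word Bool Bool → List Bool → ℤ
  | [], _ => 0
  | (k, p) :: w, s => p.sign (s.drop k) + Word.signSum w ((p.actAt k s).getD [])

/-- The writhe of an oriented diagram. -/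
def writhe (K : LinkDiagram Bool) : ℤ := Word.signSum K.1 []

/-- The Bennequin invariant of the Legendrian link with a given front. -/
def tb (l : Front Bool) : ℤ := -writhe l.morsify

/-- The Kauffman polynomial `Y = a ^ (-w) D`. -/
def kauffmanY (K : LinkDiagram Bool) : Laurent2 := aPow (-writhe K) * kauffmanD K.forget

/-- The least exponent of `a` (`⊤` for the zero polynomial). -/
def leastExponent {A : Type} [Semiring A] (f : A[T;T⁻¹]) : WithTop ℤ := f.coeff.support.min

/-- The least exponent of `a` in the Kauffman polynomial of the Legendrian link. -/
def eY (l : Front Bool) : WithTop ℤ := leastExponent (kauffmanY l.morsify)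

/-- The Laurent polynomial in `a` has no negative powers of `a`. -/
def IsGenuinePolynomial {A : Type} [Semiring A] (f : A[T;T⁻¹]) : Prop :=
  ∃ p : Polynomial A, Polynomial.toLaurent p = f

/-! ### States -/

/-- What a state does with the pieces of an unoriented front: it orients the left cusps, keeps each
crossing, or splices it horizontally into two strands, or vertically into a right cusp followed by a
left cusp (whose lower branch gets the direction `o`). -/
inductive StatePiece : Type
  | leftCusp (o : Bool)
  | rightCusp
  | keep
  | horizontal
  | vertical (o : Bool)

/-- The piece of the original front. -/
def StatePiece.source : StatePiece → Piece Unit Unit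
  | .leftCusp _ => .birth ()
  | .rightCusp => .death
  | .keep => .cross ()
  | .horizontal => .cross ()
  | .vertical _ => .cross ()

/-- The corresponding part of the spliced front. -/
def StatePiece.target (k : ℕ) : StatePiece → Word Unit Bool
  | .leftCusp o => [(k, .birth o)]
  | .rightCusp => [(k, .death)]
  | .keep => [(k, .cross ())]
  | .horizontal => []
  | .vertical o => [(k, .death), (k, .birth o)]

/-- A state of a front: a choice of splicings and an orientation of the resulting front. -/
structure State (l : Front Unit) where
  pieces : List (ℕ × StatePiece)
  source_eq : (pieces.map fun e => (e.1, e.2.source)) = l.1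
  closed : Word.run (pieces.flatMap fun e => e.2.target e.1) [] = some []

/-- The spliced, oriented front `l_σ`. -/
def State.front {l : Front Unit} (σ : State l) : Front Bool :=
  ⟨σ.pieces.flatMap fun e => e.2.target e.1, σ.closed⟩

/-- The number of left cusps oriented upward plus the number of right cusps oriented downward; at
both, the lower branch runs leftward. -/
def Word.cuspCount : Word Unit Bool → List Bool → ℕ
  | [], _ => 0
  | (k, p) :: w, s =>
    (match p, s.drop k with
      | .birth false, _ => 1
      | .death, false :: _ => 1
      | _, _ => 0) + Word.cuspCount w ((p.actAt k s).getD [])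

/-- The variable `t`; coefficients of the Jaeger formula lie in the field `ℚ(t)`. -/
def tVar : RatFunc ℚ := RatFunc.X

theorem tVar_sub_inv_ne_zero : tVar - tVar⁻¹ ≠ 0 := by
  intro h
  have h0 : (RatFunc.X : RatFunc ℚ) ≠ 0 := RatFunc.X_ne_zero
  have h1 : (RatFunc.X : RatFunc ℚ) * RatFunc.X = 1 := by
    have h2 : (RatFunc.X : RatFunc ℚ) = RatFunc.X⁻¹ := sub_eq_zero.mp h
    nth_rewrite 2 [h2]
    exact mul_inv_cancel₀ h0
  have h3 : (Polynomial.X * Polynomial.X : Polynomial ℚ) = 1 := by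
    apply RatFunc.algebraMap_injective ℚ
    simpa [RatFunc.algebraMap_X] using h1
  have h4 := congrArg Polynomial.natDegree h3
  simp at h4

/-- The substitution `z = t - t⁻¹` in coefficients. -/
def substZ : ℤ[T;T⁻¹] →+* RatFunc ℚ :=
  LaurentPolynomial.eval₂ (Int.castRingHom (RatFunc ℚ)) (Units.mk0 _ tVar_sub_inv_ne_zero)

/-- `f(z, a) ↦ f(t - t⁻¹, a)`. -/
def Laurent2.subst : Laurent2 →+* (RatFunc ℚ)[T;T⁻¹] :=
  LaurentPolynomial.eval₂ (LaurentPolynomial.C.comp substZ)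
    ⟨LaurentPolynomial.T 1, LaurentPolynomial.T (-1), by
      rw [← LaurentPolynomial.T_add]; simp, by
      rw [← LaurentPolynomial.T_add]; simp⟩

/-- Local weight; `s` lists the strands of the spliced front just left of the piece, from its height
upward.  A vertical splicing has nonzero weight if the new right cusp is oriented downward and the
new left cusp upward, a horizontal one if the lower strand runs leftward and the upper strand
rightward. -/
def StatePiece.weight : StatePiece → List Bool → (RatFunc ℚ)[T;T⁻¹]
  | .vertical false, false :: true :: _ =>
      LaurentPolynomial.C (tVar * (tVar - tVar⁻¹)) * LaurentPolynomial.T (-2)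
  | .vertical _, _ => 0
  | .horizontal, false :: true :: _ => LaurentPolynomial.C (tVar⁻¹ - tVar)
  | .horizontal, _ => 0
  | _, _ => 1

def weightProd : List (ℕ × StatePiece) → List Bool → (RatFunc ℚ)[T;T⁻¹]
  | [], _ => 1
  | (k, p) :: w, s =>
    p.weight (s.drop k) * weightProd w ((Word.run (p.target k) s).getD [])

/-- The weight `[l, σ]` of a state. -/
def State.weight {l : Front Unit} (σ : State l) : (RatFunc ℚ)[T;T⁻¹] := weightProd σ.pieces []

/-- The contribution of the state `σ` to the right side of the Legendrian Jaeger formula: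
`(a t⁻¹) ^ (number of upward left cusps and downward right cusps of l_σ) [l, σ] R(l_σ)(t - t⁻¹, a)`. -/
def State.contribution {l : Front Unit} (σ : State l) : (RatFunc ℚ)[T;T⁻¹] :=
  (LaurentPolynomial.C tVar⁻¹ * LaurentPolynomial.T 1) ^ Word.cuspCount σ.front.1 [] *
    σ.weight * Laurent2.subst (homflyR σ.front.morsify)

end

noncomputable section

open Direction

variable {κ α : Type} [DecidableEq α] [Direction α]

/-! ### Running words -/

/-! The skein relation of `R` keeps only the smoothing that respects orientations, that of `D` keeps
both. With labels `Bool` or `Unit` on the strands they become one relation, so both invariants are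
instances of `IsSkeinInvariant` and are treated together. In a morsification each right cusp carries
a positive curl worth a factor `a`. Polynomiality of the value therefore means that `a ^ deaths`
times the value of the rounded front is a polynomial in `a`; this is `Good`.

`good` proves it for all fronts by induction on the number of crossings, then on the number of left
cusps. Beyond the last left cusp there are only crossings and right cusps. Pushing that cusp across
a strand amounts, up to regular isotopy, to a crossing change, so by the skein relation it costs
only fronts with fewer crossings (`good_cusp_cross`). In this way the cusp is carried to the right,
past or through the following pieces, until a double crossing, a curl, a zigzag, a circle or two
removable crossings appear (`good_of_last_birth`). Each of these is resolved inside the class of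
fronts, with coefficients polynomial in `a`. The one dangerous value is that of the circle, but the
circle has a right cusp, and `a (a - a⁻¹) = a² - 1` (`aPow_mul_circleValue_mem`).

For states, a vertical splicing of nonzero weight has the factor `a ^ (-2)`, but it creates two
cusps counted by `cuspCount`, which compensate it; the remaining factor is a value of `R` on a
front. Finally `Y` is `a ^ tb` times the polynomial `D`, whence the bound on its least exponent. -/

theorem Piece.actAt_length_add (p : Piece κ α) (a s : List α) (n : ℕ) :
    p.actAt (a.length + n) (a ++ s) = (p.actAt n s).map (a ++ ·) := by
  induction a with
  | nil => simp
  | cons x a ih =>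
    rw [show (x :: a).length + n = (a.length + n) + 1 by simp; omega]
    simp only [List.cons_append, Piece.actAt, ih, Option.map_map]
    rfl

theorem Piece.actAt_length (p : Piece κ α) (a s : List α) :
    p.actAt a.length (a ++ s) = (p.act s).map (a ++ ·) := by
  simpa [Piece.actAt] using p.actAt_length_add a s 0

theorem Piece.exists_of_actAt {p : Piece κ α} {k : ℕ} {s s' : List α}
    (h : p.actAt k s = some s') :
    ∃ a t t', a.length = k ∧ s = a ++ t ∧ s' = a ++ t' ∧ p.act t = some t' := by
  induction k generalizing s s' with
  | zero => exact ⟨[], s, s', rfl, rfl, rfl, h⟩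
  | succ k ih =>
    rcases s with _ | ⟨x, s⟩
    · simp [Piece.actAt] at h
    · simp only [Piece.actAt, Option.map_eq_some_iff] at h
      obtain ⟨r, hr, rfl⟩ := h
      obtain ⟨a, t, t', rfl, rfl, rfl, ht⟩ := ih hr
      exact ⟨x :: a, t, t', rfl, rfl, rfl, ht⟩

theorem Word.run_append_eq_some {u v : Word κ α} {s r : List α}
    (h : Word.run (u ++ v) s = some r) :
    ∃ t, Word.run u s = some t ∧ Word.run v t = some r := by
  rwa [Word.run_append, Option.bind_eq_some_iff] at h

theorem Word.run_far (e f : Piece κ α) (k m : ℕ) (s : List α) :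
    Word.run [(k, e), (k + e.outs + m, f)] s = Word.run [(k + e.ins + m, f), (k, e)] s := by
  induction k generalizing s with
  | zero =>
    rcases e with o | _ | c
    · simp only [Word.run, Piece.actAt, Piece.act, Piece.outs, Piece.ins]
      rw [show 0 + 2 + m = m + 1 + 1 by omega, show 0 + 0 + m = m by omega]
      cases h : f.actAt m s <;> simp [Piece.actAt, h]
    · simp only [Word.run, Piece.outs, Piece.ins]
      rw [show 0 + 2 + m = m + 1 + 1 by omega, show 0 + 0 + m = m by omega]
      rcases s with _ | ⟨x, _ | ⟨y, s⟩⟩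
      · simp [Piece.actAt, Piece.act]
      · cases m <;> simp [Piece.actAt, Piece.act]
      · cases h : f.actAt m s <;> by_cases hy : y = rev x <;>
          simp [Piece.actAt, Piece.act, h, hy]
    · simp only [Word.run, Piece.outs, Piece.ins]
      rw [show 0 + 2 + m = m + 1 + 1 by omega]
      rcases s with _ | ⟨x, _ | ⟨y, s⟩⟩
      · simp [Piece.actAt, Piece.act]
      · cases m <;> simp [Piece.actAt, Piece.act]
      · cases h : f.actAt m s <;> simp [Piece.actAt, Piece.act, h]
  | succ k ih =>
    rw [show k + 1 + e.outs + m = (k + e.outs + m) + 1 by omega,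
      show k + 1 + e.ins + m = (k + e.ins + m) + 1 by omega]
    rcases s with _ | ⟨x, s⟩
    · simp [Word.run, Piece.actAt]
    · have h := congrArg (Option.map (x :: ·)) (ih s)
      have key : ∀ (i j : ℕ) (p q : Piece κ α), Word.run [(i + 1, p), (j + 1, q)] (x :: s) =
          (Word.run [(i, p), (j, q)] s).map (x :: ·) := by
        intro i j p q
        simp only [Word.run, Piece.actAt]
        cases p.actAt i s with
        | none => rfl
        | some r => cases q.actAt j r <;> simp [Piece.actAt, *]
      rw [key, key, h]

/-- Only an implication: the empty right side of `zigzag`, `zagzig` or `reidemeister2` runs on every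
list of strands, whereas the left side may reject it. -/
theorem LocalMove.run_eq {x y : Word Bool α} (h : LocalMove x y) {s r : List α}
    (hx : Word.run x s = some r) : Word.run y s = some r := by
  have key : ∀ (k : ℕ) (p : Piece Bool α) (w : Word Bool α),
      Word.run ((k, p) :: w) s = some r → ∃ a t t', a.length = k ∧ s = a ++ t ∧
        p.act t = some t' ∧ Word.run w (a ++ t') = some r := by
    intro k p w hw
    simp only [Word.run, Option.bind_eq_some_iff] at hw
    obtain ⟨_, h1, h2⟩ := hw
    obtain ⟨a, t, t', h3, h4, rfl, h5⟩ := Piece.exists_of_actAt h1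
    exact ⟨a, t, t', h3, h4, h5, h2⟩
  rcases h with ⟨e, f, k, m⟩ | ⟨k, o⟩ | ⟨k, o⟩ | ⟨k, o, c⟩ | ⟨k, c⟩ | ⟨k, c⟩ | ⟨k, c⟩
  · rwa [← Word.run_far]
  · obtain ⟨a, t, t', rfl, rfl, h1, h2⟩ := key _ _ _ hx
    simp only [Piece.act, Option.some.injEq] at h1
    subst h1
    rcases t with _ | ⟨z, t⟩ <;>
      simp_all [Word.run, Piece.actAt_length_add, Piece.actAt, Piece.act, rev_rev]
  · obtain ⟨a, t, t', h0, rfl, h1, h2⟩ := key _ _ _ hx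
    simp only [Piece.act, Option.some.injEq] at h1
    subst h1
    obtain rfl | ⟨b, z, rfl⟩ := List.eq_nil_or_concat' a
    · simp at h0
    have h0 : b.length = k := by simpa using h0
    subst h0
    simp only [List.append_assoc, List.singleton_append, Word.run,
      Piece.actAt_length, Piece.act] at h2
    by_cases ho : o = rev z
    · subst ho
      simpa [rev_rev, Word.run] using h2
    · simp [ho] at h2
  · obtain ⟨a, t, t', rfl, rfl, h1, h2⟩ := key _ _ _ hx
    simp only [Piece.act, Option.some.injEq] at h1
    subst h1
    rcases t with _ | ⟨z, t⟩
    · simp [Word.run, Piece.actAt_length_add, Piece.actAt, Piece.act] at h2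
    · simp [Word.run, Piece.actAt_length_add, Piece.actAt_length, Piece.actAt, Piece.act] at h2 ⊢
      exact h2
  · obtain ⟨a, t, t', h0, rfl, h1, h2⟩ := key _ _ _ hx
    obtain rfl | ⟨b, z, rfl⟩ := List.eq_nil_or_concat' a
    · simp at h0
    have h0 : b.length = k := by simpa using h0
    subst h0
    rcases t with _ | ⟨x, _ | ⟨y, t⟩⟩ <;> simp only [Piece.act, reduceCtorEq, Option.some.injEq] at h1
    subst h1
    by_cases ho : y = rev z <;>
    simp_all [Word.run, Piece.actAt_length_add, Piece.actAt_length, Piece.actAt, Piece.act]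
  · obtain ⟨a, t, t', rfl, rfl, h1, h2⟩ := key _ _ _ hx
    rcases t with _ | ⟨x, _ | ⟨y, t⟩⟩ <;> simp only [Piece.act, reduceCtorEq, Option.some.injEq] at h1
    subst h1
    simpa [Word.run, Piece.actAt_length, Piece.act] using h2
  · obtain ⟨a, t, t', rfl, rfl, h1, h2⟩ := key _ _ _ hx
    rcases t with _ | ⟨x, _ | ⟨y, _ | ⟨z, t⟩⟩⟩ <;>
    simp only [Piece.act, reduceCtorEq, Option.some.injEq] at h1 <;> subst h1 <;>
    simp [Word.run, Piece.actAt_length_add, Piece.actAt_length, Piece.actAt, Piece.act] at h2 ⊢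
    exact h2

/-! ### Skein invariants with values on all words -/

/-- The value of an invariant on a word, `0` when the word is not closed. -/
def Word.val (F : LinkDiagram α → Laurent2) (w : Word Bool α) : Laurent2 :=
  if h : Word.run w [] = some [] then F ⟨w, h⟩ else 0

open Word

/-- The common form of the defining relations of `R` and `D`.  In the skein relation the vertical
smoothing is present when the strands are opposite, the horizontal one when they are parallel;
unoriented strands are both. -/
structure IsSkeinInvariant (F : LinkDiagram α → Laurent2) : Prop where
  label : ∀ x y : α, y = x ∨ y = rev x
  regular : ∀ K L, RegularIsotopic K L → F K = F L
  empty : val F [] = 1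
  circle : ∀ o : α, val F [(0, .birth o), (0, .death)] =
    (aPow 1 - aPow (-1)) * zPow (-1) + if rev o = o then 1 else 0
  skein : ∀ (u v : Word Bool α) (b t : List α) (x y : α),
    Word.run u [] = some (b ++ x :: y :: t) →
    val F (u ++ [(b.length, .cross true)] ++ v) - val F (u ++ [(b.length, .cross false)] ++ v) =
      zPow 1 * ((if y = rev x then
          val F (u ++ [(b.length, .death), (b.length, .birth (rev x))] ++ v) else 0) -
        if x = y then val F (u ++ v) else 0)
  kink : ∀ (c : Bool) (u x v : Word Bool α), Kink c x →
    Word.run (u ++ x ++ v) [] = some [] → Word.run (u ++ v) [] = some [] →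
    val F (u ++ x ++ v) = aPow (if c then -1 else 1) * val F (u ++ v)

/-- Since `val` is `0` on words that are not closed, a relation between values requires its words to
be closed simultaneously; this is what guarantees it. -/
theorem Word.run_context {u v x y : Word κ α} {s : List α} (hu : Word.run u [] = some s)
    (hxy : Word.run x s = Word.run y s) :
    Word.run (u ++ x ++ v) [] = Word.run (u ++ y ++ v) [] := by
  simp [Word.run_append, hu, hxy]

theorem Word.run_cross (c : κ) (b t : List α) (x y : α) :
    Word.run [(b.length, .cross c)] (b ++ x :: y :: t) = some (b ++ y :: x :: t) := by
  simp [Word.run, Piece.actAt_length, Piece.act]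

theorem Word.run_death_birth (b t : List α) (x : α) :
    Word.run [(b.length, (.death : Piece κ α)), (b.length, .birth (rev x))] (b ++ x :: rev x :: t) =
      some (b ++ rev x :: x :: t) := by
  simp [Word.run, Piece.actAt_length, Piece.act, rev_rev]

theorem Word.val_of_closed {F : LinkDiagram α → Laurent2} {w : Word Bool α}
    (h : Word.run w [] = some []) : val F w = F ⟨w, h⟩ := dif_pos h

theorem Word.val_of_not_closed {F : LinkDiagram α → Laurent2} {w : Word Bool α}
    (h : Word.run w [] ≠ some []) : val F w = 0 := dif_neg h

theorem IsHomflyR.isSkeinInvariant {R : LinkDiagram Bool → Laurent2} (hR : IsHomflyR R) :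
    IsSkeinInvariant R where
  label := by decide
  regular := hR.regular
  empty := by
    rw [val_of_closed (by rfl)]
    exact hR.empty _ rfl
  circle o := by
    have hc : Word.run [(0, (.birth o : Piece Bool Bool)), (0, .death)] [] = some [] := by
      cases o <;> rfl
    rw [val_of_closed hc, hR.circle ⟨_, hc⟩ o rfl]
    cases o <;> simp [rev]
  skein u v b t x y hu := by
    have h12 : Word.run (u ++ [(b.length, .cross true)] ++ v) [] =
        Word.run (u ++ [(b.length, .cross false)] ++ v) [] :=
      run_context hu (by rw [run_cross, run_cross])
    by_cases hxy : x = y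
    · subst hxy
      have h10 : Word.run (u ++ [(b.length, .cross true)] ++ v) [] = Word.run (u ++ v) [] := by
        simpa using run_context (x := [(b.length, .cross true)]) (y := []) (v := v) hu
          (by rw [run_cross]; rfl)
      have hne : x ≠ rev x := by cases x <;> simp [rev]
      rw [if_neg hne, if_pos rfl]
      by_cases hc : Word.run (u ++ v) [] = some []
      · rw [val_of_closed hc, val_of_closed (h10.trans hc), val_of_closed (h12.symm.trans (h10.trans hc))]
        have := hR.skein ⟨_, h12.symm.trans (h10.trans hc)⟩ ⟨_, h10.trans hc⟩ ⟨_, hc⟩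
          (.parallel u v b t x hu)
        -- For parallel strands the positive crossing is the one of type `false`, hence the sign.
        linear_combination -this
      · rw [val_of_not_closed hc, val_of_not_closed (by rwa [h10]),
          val_of_not_closed (by rwa [← h12, h10])]
        simp
    · obtain rfl : y = rev x := by cases x <;> cases y <;> simp_all [rev]
      have h10 : Word.run (u ++ [(b.length, .cross true)] ++ v) [] =
          Word.run (u ++ [(b.length, .death), (b.length, .birth (rev x))] ++ v) [] :=
        run_context hu (by rw [run_cross, run_death_birth])
      rw [if_pos rfl, if_neg hxy]
      by_cases hc : Word.run (u ++ [(b.length, .cross true)] ++ v) [] = some []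
      · rw [val_of_closed hc, val_of_closed (h10.symm.trans hc), val_of_closed (h12.symm.trans hc)]
        have := hR.skein ⟨_, hc⟩ ⟨_, h12.symm.trans hc⟩ ⟨_, h10.symm.trans hc⟩
          (.antiparallel u v b t x hu)
        linear_combination this
      · rw [val_of_not_closed hc, val_of_not_closed fun h => hc (h12.trans h),
          val_of_not_closed fun h => hc (h10.trans h)]
        simp
  kink c u x v hx h h' := by
    rw [val_of_closed h, val_of_closed h']
    exact hR.kink _ _ c u x v hx rfl rfl

theorem IsKauffmanD.isSkeinInvariant {D : LinkDiagram Unit → Laurent2} (hD : IsKauffmanD D) :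
    IsSkeinInvariant D where
  label _ _ := Or.inl rfl
  regular := hD.regular
  empty := by
    rw [val_of_closed (by rfl)]
    exact hD.empty _ rfl
  circle o := by
    have hc : Word.run [(0, (.birth o : Piece Bool Unit)), (0, .death)] [] = some [] := rfl
    rw [val_of_closed hc, hD.circle ⟨_, hc⟩ rfl]
    simp [rev]
  skein u v b t x y hu := by
    have h12 : Word.run (u ++ [(b.length, .cross true)] ++ v) [] =
        Word.run (u ++ [(b.length, .cross false)] ++ v) [] :=
      run_context hu (by rw [run_cross, run_cross])
    have h10 : Word.run (u ++ [(b.length, .cross true)] ++ v) [] = Word.run (u ++ v) [] := by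
      simpa using run_context (x := [(b.length, .cross true)]) (y := []) (v := v) hu
          (by rw [run_cross]; rfl)
    have h13 : Word.run (u ++ [(b.length, .cross true)] ++ v) [] =
        Word.run (u ++ [(b.length, .death), (b.length, .birth (rev x))] ++ v) [] :=
      run_context hu (by rw [run_cross, show y = rev x from rfl, run_death_birth])
    rw [if_pos rfl, if_pos rfl]
    by_cases hc : Word.run (u ++ [(b.length, .cross true)] ++ v) [] = some []
    · rw [val_of_closed hc, val_of_closed (h10.symm.trans hc), val_of_closed (h12.symm.trans hc),
        val_of_closed (h13.symm.trans hc)]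
      exact hD.skein _ _ _ _ u v b.length rfl rfl rfl rfl
    · rw [val_of_not_closed hc, val_of_not_closed fun h => hc (h12.trans h),
        val_of_not_closed fun h => hc (h13.trans h), val_of_not_closed fun h => hc (h10.trans h)]
      simp
  kink c u x v hx h h' := by
    rw [val_of_closed h, val_of_closed h']
    exact hD.kink _ _ c u x v hx rfl rfl

end

noncomputable section

open Direction

variable {κ α : Type} [DecidableEq α] [Direction α]

open Word

theorem aPow_mul (m n : ℤ) : aPow m * aPow n = aPow (m + n) :=
  (LaurentPolynomial.T_add m n).symm

theorem zPow_mul (m n : ℤ) : zPow m * zPow n = zPow (m + n) := by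
  simp only [zPow, ← map_mul, LaurentPolynomial.T_add]

theorem aPow_zero : aPow 0 = 1 := LaurentPolynomial.T_zero

theorem zPow_zero : zPow 0 = 1 := by simp [zPow]

namespace IsSkeinInvariant

variable {F : LinkDiagram α → Laurent2} {u v : Word Bool α}
  {b t s : List α} {x y o : α}

/-! ### Local relations between values -/

/-- The extra prefix `c` lets a move happen behind some pieces while `u` remains the common context.
Only `x` has to be checked to run, by `LocalMove.run_eq`. -/
theorem val_move (hF : IsSkeinInvariant F)
    {c x y : Word Bool α} (h : LocalMove x y) (hu : run (u ++ c) [] = some s)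
    (hx : (run x s).isSome) : val F (u ++ (c ++ (x ++ v))) = val F (u ++ (c ++ (y ++ v))) := by
  obtain ⟨r, hr⟩ := Option.isSome_iff_exists.1 hx
  have e : run (u ++ (c ++ (x ++ v))) [] = run (u ++ (c ++ (y ++ v))) [] := by
    rw [← List.append_assoc, ← List.append_assoc, ← List.append_assoc u, ← List.append_assoc _ y]
    exact run_context hu (hr.trans (h.run_eq hr).symm)
  by_cases hc : run (u ++ (c ++ (x ++ v))) [] = some []
  · rw [val_of_closed hc, val_of_closed (e.symm.trans hc)]
    exact hF.regular _ _ (.rel _ _ ⟨u ++ c, v, x, y, h, by simp, by simp⟩)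
  · rw [val_of_not_closed hc, val_of_not_closed fun h => hc (e.trans h)]

/-- No fitting condition is needed here, because `run_far` is an equality of partial maps. -/
theorem val_far (hF : IsSkeinInvariant F) (e f : Piece Bool α) (k m : ℕ) :
    val F (u ++ (k, e) :: (k + e.outs + m, f) :: v) =
      val F (u ++ (k + e.ins + m, f) :: (k, e) :: v) := by
  have key : run (u ++ (k, e) :: (k + e.outs + m, f) :: v) [] =
      run (u ++ (k + e.ins + m, f) :: (k, e) :: v) [] := by
    rw [run_append, run_append]
    congr 1
    funext s
    have := congrArg (fun r => r.bind (run v)) (run_far e f k m s)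
    simpa only [← run_append, List.cons_append, List.nil_append] using this
  by_cases hc : run (u ++ (k, e) :: (k + e.outs + m, f) :: v) [] = some []
  · rw [val_of_closed hc, val_of_closed (key.symm.trans hc)]
    exact hF.regular _ _ (.rel _ _ ⟨u, v, _, _, .far e f k m, by simp, by simp⟩)
  · rw [val_of_not_closed hc, val_of_not_closed fun h => hc (key.trans h)]

theorem val_kink (hF : IsSkeinInvariant F)
    {c : Bool} {w : Word Bool α} (hw : Kink c w) (hu : run u [] = some s)
    (hs : run w s = some s) : val F (u ++ (w ++ v)) = aPow (if c then -1 else 1) * val F (u ++ v) := by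
  have e : run (u ++ w ++ v) [] = run (u ++ v) [] := by simp [run_append, hu, hs]
  rw [← List.append_assoc]
  by_cases hc : run (u ++ v) [] = some []
  · exact hF.kink c u w v hw (e.trans hc) hc
  · rw [val_of_not_closed hc, val_of_not_closed fun h => hc (e.symm.trans h), mul_zero]

/-- A zigzag inserted into the upper strand between the crossing and the turn lets the crossing
slide around the turn, where it becomes a standard positive kink on the upper strand. -/
theorem val_curl_death (hF : IsSkeinInvariant F) (hu : run u [] = some (b ++ x :: rev x :: t)) :
    val F (u ++ (b.length, .cross true) :: (b.length, .death) :: v) =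
      aPow 1 * val F (u ++ (b.length, .death) :: v) := by
  have e1 := hF.val_move (u := u) (v := (b.length, .death) :: v) (c := [(b.length, .cross true)])
    (.zagzig (b.length + 1) (rev x)) (s := b ++ rev x :: x :: t)
    (by simp [run_append, hu, run, Piece.actAt_length, Piece.act])
    (by simp [run, Piece.actAt_length_add, Piece.actAt, Piece.act, rev_rev, add_assoc])
  have e2 := hF.val_far (u := u) (v := (b.length + 1, .death) :: (b.length, .death) :: v)
    (.cross true) (.birth (rev x)) b.length 0
  have e3 := hF.val_move (u := u) (v := (b.length, .death) :: v)
    (c := [(b.length + 2, .birth (rev x))])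
    (.slideDeath b.length false) (s := b ++ x :: rev x :: rev x :: x :: t)
    (by simp [run_append, hu, run, Piece.actAt_length_add, Piece.actAt, Piece.act, rev_rev])
    (by simp [run, Piece.actAt_length, Piece.actAt_length_add, Piece.actAt, Piece.act])
  have e4 := hF.val_far
    (u := u ++ [(b.length + 2, .birth (rev x)), (b.length + 1, .cross false)]) (v := v)
    .death .death b.length 0
  have e5 := hF.val_kink (u := u) (v := (b.length, .death) :: v) (.above (c := false)
    (b.length + 1) (rev x)) hu
    (by simp [run, Piece.actAt_length_add, Piece.actAt, Piece.act, rev_rev, add_assoc])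
  simp only [List.cons_append, List.nil_append, List.append_assoc, Piece.outs, Piece.ins, add_zero,
    Bool.not_false, Bool.false_eq_true, if_false, add_assoc, Nat.reduceAdd] at e1 e2 e3 e4 e5 ⊢
  rw [← e1, e2, ← e3, e4, e5]

/-- The mirror argument at a left turn. The crossing interchanges the branches, so removing it
reverses the label of the turn. -/
theorem val_curl_birth (hF : IsSkeinInvariant F) (hu : run u [] = some (b ++ t)) :
    val F (u ++ (b.length, .birth o) :: (b.length, .cross true) :: v) =
      aPow 1 * val F (u ++ (b.length, .birth (rev o)) :: v) := by
  have e1 := hF.val_move (u := u) (v := (b.length, .cross true) :: v) (c := [(b.length, .birth o)])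
    (.zigzag (b.length + 1) (rev o)) (s := b ++ o :: rev o :: t)
    (by simp [run_append, hu, run, Piece.actAt_length, Piece.act])
    (by simp [run, Piece.actAt_length_add, Piece.actAt, Piece.act, rev_rev, add_assoc])
  have e2 := hF.val_far (u := u ++ [(b.length, .birth o), (b.length + 1, .birth (rev o))]) (v := v)
    (.cross true) .death b.length 0
  have e3 := hF.val_move (u := u) (v := (b.length + 2, .death) :: v)
    (c := [(b.length, .birth o)])
    (.slideBirth b.length (rev o) false) (s := b ++ o :: rev o :: t)
    (by simp [run_append, hu, run, Piece.actAt_length, Piece.act])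
    (by simp [run, Piece.actAt_length, Piece.actAt_length_add, Piece.actAt, Piece.act, rev_rev])
  have e4 := hF.val_far (u := u) (v := (b.length + 1, .cross false) :: (b.length + 2, .death) :: v)
    (.birth (rev o)) (.birth o) b.length 0
  have e5 := hF.val_kink (u := u ++ [(b.length, .birth (rev o))]) (v := v) (.above (c := false)
    (b.length + 1) o) (s := b ++ rev o :: o :: t)
    (by simp [run_append, hu, run, Piece.actAt_length, Piece.act, rev_rev])
    (by simp [run, Piece.actAt_length_add, Piece.actAt, Piece.act, add_assoc])
  simp only [List.cons_append, List.nil_append, List.append_assoc, Piece.outs, Piece.ins, add_zero,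
    Bool.not_false, Bool.false_eq_true, if_false, add_assoc, Nat.reduceAdd] at e1 e2 e3 e4 e5 ⊢
  rw [← e1, ← e2, ← e3, ← e4, e5]

/-- Skein relation at the second crossing: after the crossing change the two crossings cancel, the
horizontal smoothing leaves the first one, and the vertical smoothing turns the first one into a
positive curl at a right turn, whence the factor `a`. -/
theorem val_double_cross (hF : IsSkeinInvariant F) (hu : run u [] = some (b ++ x :: y :: t)) :
    val F (u ++ (b.length, .cross true) :: (b.length, .cross true) :: v) =
      val F (u ++ v) + zPow 1 * ((if x = rev y then
          aPow 1 * val F (u ++ (b.length, .death) :: (b.length, .birth (rev y)) :: v) else 0) -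
        if y = x then val F (u ++ (b.length, .cross true) :: v) else 0) := by
  have e1 := hF.skein (u ++ [(b.length, .cross true)]) v b t y x
    (by simp [run_append, hu, run, Piece.actAt_length, Piece.act])
  have e2 := hF.val_move (u := u) (v := v) (c := []) (.reidemeister2 b.length true)
    (by simpa using hu)
    (by simp [run, Piece.actAt_length, Piece.act])
  simp only [List.cons_append, List.nil_append, List.append_assoc, Bool.not_true] at e1 e2
  rw [e2] at e1
  by_cases hx : x = rev y
  · have e3 := hF.val_curl_death (v := (b.length, .birth (rev y)) :: v) (u := u) (b := b) (x := x)
      (t := t) (by rw [hu, hx, rev_rev])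
    rw [if_pos hx] at e1 ⊢
    rw [e3] at e1
    linear_combination e1
  · rw [if_neg hx] at e1 ⊢
    linear_combination e1

/-- Sliding the turn through the strand is an isotopy that reverses the type of the crossing; the
skein relation restores it. In the vertical smoothing a zigzag straightens, so both corrections have
just a left turn and no crossing. -/
theorem val_cusp_cross (hF : IsSkeinInvariant F) (hu : run u [] = some (b ++ x :: t)) :
    val F (u ++ (b.length + 1, .birth o) :: (b.length, .cross true) :: v) =
      val F (u ++ (b.length, .birth o) :: (b.length + 1, .cross true) :: v) -
      zPow 1 * ((if x = o then val F (u ++ (b.length + 1, .birth o) :: v) else 0) -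
        if rev o = x then val F (u ++ (b.length, .birth o) :: v) else 0) := by
  have e1 := hF.skein (u ++ [(b.length, .birth o)]) v (b ++ [o]) t (rev o) x
    (by simp [run_append, hu, run, Piece.actAt_length, Piece.act])
  have e2 := hF.val_move (u := u) (v := v) (c := []) (.slideBirth b.length o false)
    (by simpa using hu)
    (by simp [run, Piece.actAt_length, Piece.actAt_length_add, Piece.act, Piece.actAt])
  simp only [List.cons_append, List.nil_append, List.append_assoc, Bool.not_false, rev_rev,
    List.length_append, List.length_singleton] at e1 e2
  rw [e2] at e1
  by_cases hx : x = o
  · have e3 := hF.val_move (u := u) (v := (b.length + 1, .birth o) :: v) (c := [])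
      (.zigzag b.length o) (by simpa using hu)
      (by simp [run, Piece.actAt_length, Piece.actAt_length_add, Piece.act, Piece.actAt, hx, rev_rev])
    simp only [List.cons_append, List.nil_append] at e3
    rw [if_pos hx] at e1 ⊢
    rw [e3] at e1
    linear_combination -e1
  · rw [if_neg hx] at e1 ⊢
    linear_combination -e1

/-- Sliding the right turn through the strand reverses one of the two crossings, after which they
cancel. -/
theorem val_cross_cross_death (hF : IsSkeinInvariant F)
    (hu : run u [] = some (b ++ o :: x :: rev x :: t)) :
    val F (u ++ (b.length, .cross true) :: (b.length + 1, .cross true) :: (b.length, .death) :: v) =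
      val F (u ++ (b.length + 1, .death) :: v) := by
  have e1 := hF.val_move (u := u) (v := v) (c := [(b.length, .cross true)])
    (.slideDeath b.length true) (s := b ++ x :: o :: rev x :: t)
    (by simp [run_append, hu, run, Piece.actAt_length, Piece.act])
    (by simp [run, Piece.actAt_length, Piece.actAt_length_add, Piece.act, Piece.actAt])
  have e2 := hF.val_move (u := u) (v := (b.length + 1, .death) :: v) (c := [])
    (.reidemeister2 b.length true) (by simpa using hu) (by simp [run, Piece.actAt_length, Piece.act])
  simp only [List.cons_append, List.nil_append, Bool.not_true] at e1 e2
  rw [e1, e2]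

/-! ### Split circles -/

/-- A figure eight is a positive curl both at its left turn and at its right turn; the two readings
give circles of opposite orientations with the same factor `a`. -/
theorem val_circle_rev (hF : IsSkeinInvariant F) (hu : run u [] = some (b ++ t)) :
    val F (u ++ (b.length, .birth (rev o)) :: (b.length, .death) :: v) =
      val F (u ++ (b.length, .birth o) :: (b.length, .death) :: v) := by
  have e1 := hF.val_curl_birth (o := o) (v := (b.length, .death) :: v) hu
  have e2 := hF.val_curl_death (u := u ++ [(b.length, .birth o)]) (b := b) (x := o) (t := t) (v := v)
    (by simp [run_append, hu, run, Piece.actAt_length, Piece.act])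
  simp only [List.cons_append, List.nil_append, List.append_assoc] at e2
  rw [e1] at e2
  have := congrArg (aPow (-1) * ·) e2
  simpa [← mul_assoc, aPow_mul, aPow_zero] using this

/-- The value of a split circle. -/
def circleValue (o : α) : Laurent2 :=
  (aPow 1 - aPow (-1)) * zPow (-1) + if rev o = o then 1 else 0

theorem circleValue_rev (o : α) : circleValue (rev o) = circleValue o := by
  have : rev (rev o) = rev o ↔ rev o = o := by rw [rev_rev, eq_comm]
  simp only [circleValue, this]

/-- Skein relation at the crossing of a small curl on the neighbouring strand. The two types give
the factors `a⁻¹` and `a`, the horizontal smoothing splits off the circle, and the vertical one,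
present only for unoriented strands, straightens to the strand. Solving for the circle divides by
`z`. -/
theorem val_circle_above (hF : IsSkeinInvariant F) (hu : run u [] = some (b ++ x :: t)) :
    val F (u ++ (b.length + 1, .birth o) :: (b.length + 1, .death) :: v) =
      circleValue o * val F (u ++ v) := by
  have main : val F (u ++ (b.length + 1, .birth x) :: (b.length + 1, .death) :: v) =
      circleValue x * val F (u ++ v) := by
    have e1 := hF.skein (u ++ [(b.length + 1, .birth x)]) ((b.length + 1, .death) :: v) b
      (rev x :: t) x x (by simp [run_append, hu, run, Piece.actAt_length_add, Piece.actAt, Piece.act])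
    have hk : ∀ c, val F (u ++ (b.length + 1, .birth x) :: (b.length, .cross c) ::
        (b.length + 1, .death) :: v) = aPow (if c then -1 else 1) * val F (u ++ v) := fun c =>
      hF.val_kink (.above (c := c) b.length x) hu
        (by simp [run, Piece.actAt_length, Piece.actAt_length_add, Piece.actAt, Piece.act])
    simp only [List.cons_append, List.nil_append, List.append_assoc, hk, if_true,
      Bool.false_eq_true, if_false] at e1
    have e2 : (if x = rev x then val F (u ++ (b.length + 1, .birth x) :: (b.length, .death) ::
        (b.length, .birth (rev x)) :: (b.length + 1, .death) :: v) else 0) =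
        (if rev x = x then 1 else 0) * val F (u ++ v) := by
      by_cases hx : rev x = x
      · have e3 := hF.val_move (u := u) (c := [])
          (v := (b.length, .birth (rev x)) :: (b.length + 1, .death) :: v)
          (.zagzig b.length x) (by simpa using hu)
          (by simp [run, Piece.actAt_length, Piece.actAt_length_add, Piece.act, Piece.actAt, hx])
        have e4 := hF.val_move (u := u) (c := []) (v := v)
          (.zigzag b.length (rev x)) (by simpa using hu)
          (by simp [run, Piece.actAt_length, Piece.actAt_length_add, Piece.act, Piece.actAt, hx])
        simp only [List.cons_append, List.nil_append] at e3 e4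
        rw [if_pos hx.symm, if_pos hx, e3, e4, one_mul]
      · rw [if_neg (Ne.symm hx), if_neg hx, zero_mul]
    rw [e2] at e1
    have hz : zPow (-1) * zPow 1 = 1 := by rw [zPow_mul]; exact zPow_zero
    unfold circleValue
    linear_combination zPow (-1) * e1 + (-val F (u ++ (b.length + 1, .birth x) ::
      (b.length + 1, .death) :: v) + (if rev x = x then 1 else 0) * val F (u ++ v)) * hz
  -- The curl only produces the circle labelled like the strand; `val_circle_rev` supplies the other
  -- orientation.
  obtain rfl | rfl := hF.label x o
  · exact main
  · have := hF.val_circle_rev (u := u) (v := v) (b := b ++ [x]) (t := t) (o := x) (by simpa using hu)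
    rw [circleValue_rev, ← main]
    simpa using this

theorem val_circle_below (hF : IsSkeinInvariant F) (hu : run u [] = some (b ++ x :: t)) :
    val F (u ++ (b.length, .birth o) :: (b.length, .death) :: v) =
      circleValue o * val F (u ++ v) := by
  have main : val F (u ++ (b.length, .birth (rev x)) :: (b.length, .death) :: v) =
      circleValue x * val F (u ++ v) := by
    have e1 := hF.skein (u ++ [(b.length, .birth (rev x))]) ((b.length, .death) :: v) (b ++ [rev x])
      t x x (by simp [run_append, hu, run, Piece.actAt_length, Piece.act, rev_rev])
    have hk : ∀ c, val F (u ++ (b.length, .birth (rev x)) :: (b.length + 1, .cross c) ::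
        (b.length, .death) :: v) = aPow (if c then -1 else 1) * val F (u ++ v) := fun c =>
      hF.val_kink (.below (c := c) b.length (rev x)) hu
        (by simp [run, Piece.actAt_length, Piece.actAt_length_add, Piece.actAt, Piece.act, rev_rev])
    simp only [List.cons_append, List.nil_append, List.append_assoc, List.length_append,
      List.length_singleton, hk, if_true, Bool.false_eq_true, if_false] at e1
    have e2 : (if x = rev x then val F (u ++ (b.length, .birth (rev x)) :: (b.length + 1, .death) ::
        (b.length + 1, .birth (rev x)) :: (b.length, .death) :: v) else 0) =
        (if rev x = x then 1 else 0) * val F (u ++ v) := by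
      by_cases hx : rev x = x
      · have e3 := hF.val_move (u := u) (c := [])
          (v := (b.length + 1, .birth (rev x)) :: (b.length, .death) :: v)
          (.zigzag b.length (rev x)) (by simpa using hu)
          (by simp [run, Piece.actAt_length, Piece.actAt_length_add, Piece.act, Piece.actAt, hx])
        have e4 := hF.val_move (u := u) (c := []) (v := v)
          (.zagzig b.length (rev x)) (by simpa using hu)
          (by simp [run, Piece.actAt_length, Piece.actAt_length_add, Piece.act, Piece.actAt])
        simp only [List.cons_append, List.nil_append] at e3 e4
        rw [if_pos hx.symm, if_pos hx, e3, e4, one_mul]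
      · rw [if_neg (Ne.symm hx), if_neg hx, zero_mul]
    rw [e2] at e1
    have hz : zPow (-1) * zPow 1 = 1 := by rw [zPow_mul]; exact zPow_zero
    unfold circleValue
    linear_combination zPow (-1) * e1 + (-val F (u ++ (b.length, .birth (rev x)) ::
      (b.length, .death) :: v) + (if rev x = x then 1 else 0) * val F (u ++ v)) * hz
  obtain rfl | rfl := hF.label x o
  · rw [← main, hF.val_circle_rev hu]
  · rw [circleValue_rev, ← main]

/-- If no strand is beside the circle, it slides past an adjacent piece, a right turn before it or a
left turn after it, and then lies above a strand. If there is no piece either, the circle is the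
whole diagram. -/
theorem val_circle (hF : IsSkeinInvariant F) (hu : run u [] = some (b ++ t)) :
    val F (u ++ (b.length, .birth o) :: (b.length, .death) :: v) =
      circleValue o * val F (u ++ v) := by
  rcases t with _ | ⟨x, t⟩
  swap
  · exact hF.val_circle_below hu
  rcases List.eq_nil_or_concat' b with rfl | ⟨b, x, rfl⟩
  swap
  · have := hF.val_circle_above (u := u) (v := v) (b := b) (x := x) (t := []) (o := o)
      (by simpa using hu)
    simpa using this
  have e0 : run (u ++ (0, .birth o) :: (0, .death) :: v) [] = run (u ++ v) [] := by
    simp [run_append, hu, run, Piece.actAt, Piece.act]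
  simp only [List.append_nil, List.length_nil] at hu ⊢
  by_cases hc : run (u ++ v) [] = some []
  swap
  · rw [val_of_not_closed hc, val_of_not_closed fun h => hc (e0.symm.trans h), mul_zero]
  rcases List.eq_nil_or_concat' u with rfl | ⟨u, ⟨j, p⟩, rfl⟩
  · rcases v with _ | ⟨⟨j, p⟩, v⟩
    · simpa [hF.empty, circleValue] using hF.circle o
    · obtain ⟨_, h1, -⟩ := Word.run_append_eq_some (u := [(j, p)]) hc
      simp only [run, Option.bind_fun_some] at h1
      obtain ⟨a, t, t', rfl, h3, rfl, h5⟩ := Piece.exists_of_actAt h1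
      obtain ⟨rfl, rfl⟩ := List.append_eq_nil_iff.1 h3.symm
      rcases p with o' | _ | c <;> simp [Piece.act] at h5
      have e1 := hF.val_far (u := [(0, .birth o)]) (v := v) (.birth o') .death 0 0
      have e2 := hF.val_far (u := []) (v := (2, .death) :: v) (.birth o') (.birth o) 0 0
      have e3 := hF.val_circle_above (u := [(0, .birth o')]) (v := v) (b := [o']) (x := rev o')
        (t := []) (o := o) rfl
      simp only [List.cons_append, List.nil_append, Piece.outs, Piece.ins, add_zero, zero_add,
        List.length_nil, List.length_singleton, Nat.reduceAdd] at e1 e2 e3 ⊢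
      rw [← e1, ← e2, e3]
  · obtain ⟨s, h1, h2⟩ := Word.run_append_eq_some hu
    simp only [run, Option.bind_fun_some] at h2
    obtain ⟨a, t, t', rfl, rfl, h4, h5⟩ := Piece.exists_of_actAt h2
    obtain ⟨rfl, rfl⟩ := List.append_eq_nil_iff.1 h4.symm
    rcases p with o' | _ | c <;> rcases t with _ | ⟨x, _ | ⟨y, t⟩⟩ <;> simp [Piece.act] at h5
    obtain ⟨rfl, rfl⟩ := h5
    have e1 := hF.val_far (u := u) (v := (0, .death) :: v) .death (.birth o) 0 0
    have e2 := hF.val_far (u := u ++ [(2, .birth o)]) (v := v) .death .death 0 0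
    have e3 := hF.val_circle_above (u := u) (v := (0, .death) :: v) (b := [x]) (x := rev x)
        (t := []) (o := o) h1
    simp only [List.cons_append, List.nil_append, List.append_assoc, Piece.outs, Piece.ins,
      add_zero, zero_add, List.length_nil, List.length_singleton, Nat.reduceAdd] at e1 e2 e3 ⊢
    rw [e1, e2, e3]

end IsSkeinInvariant

end

noncomputable section

open Direction

variable {κ α : Type}

open Word

/-! ### Fronts -/

/-- The piece of a link diagram with the strand of positive slope over at crossings. -/
def Piece.over : Piece Unit α → Piece Bool α
  | .birth o => .birth o
  | .death => .death
  | .cross _ => .cross true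

/-- The link diagram of a front with both kinds of cusps rounded. -/
def Word.over (w : Word Unit α) : Word Bool α := w.map fun e => (e.1, e.2.over)

theorem Word.over_append (u v : Word Unit α) : Word.over (u ++ v) = Word.over u ++ Word.over v :=
  List.map_append

theorem Word.over_cons (k : ℕ) (p : Piece Unit α) (w : Word Unit α) :
    Word.over ((k, p) :: w) = (k, p.over) :: Word.over w := rfl

theorem Piece.outs_over (p : Piece Unit α) : p.over.outs = p.outs := by cases p <;> rfl

theorem Piece.ins_over (p : Piece Unit α) : p.over.ins = p.ins := by cases p <;> rfl

/-- The number of cusps pointing rightward. -/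
def Word.deaths (w : Word κ α) : ℕ := (w.map fun e => match e.2 with | .death => 1 | _ => 0).sum

/-- The number of cusps pointing leftward. -/
def Word.births (w : Word κ α) : ℕ := (w.map fun e => match e.2 with | .birth _ => 1 | _ => 0).sum

/-- The number of crossings. -/
def Word.crossings (w : Word κ α) : ℕ :=
  (w.map fun e => match e.2 with | .cross _ => 1 | _ => 0).sum

theorem Word.deaths_append (u v : Word κ α) : deaths (u ++ v) = deaths u + deaths v := by
  simp [deaths]

theorem Word.births_append (u v : Word κ α) : births (u ++ v) = births u + births v := by
  simp [births]

theorem Word.crossings_append (u v : Word κ α) :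
    crossings (u ++ v) = crossings u + crossings v := by
  simp [crossings]

theorem Word.deaths_cons (k : ℕ) (p : Piece κ α) (w : Word κ α) :
    deaths ((k, p) :: w) = (match p with | .death => 1 | _ => 0) + deaths w := by
  simp [deaths]

theorem Word.births_cons (k : ℕ) (p : Piece κ α) (w : Word κ α) :
    births ((k, p) :: w) = (match p with | .birth _ => 1 | _ => 0) + births w := by
  simp [births]

theorem Word.crossings_cons (k : ℕ) (p : Piece κ α) (w : Word κ α) :
    crossings ((k, p) :: w) = (match p with | .cross _ => 1 | _ => 0) + crossings w := by
  simp [crossings]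

theorem Word.crossings_nil : crossings ([] : Word κ α) = 0 := rfl

theorem Word.births_nil : births ([] : Word κ α) = 0 := rfl

variable [DecidableEq α] [Direction α]

theorem Piece.act_over (p : Piece Unit α) (s : List α) : p.over.act s = p.act s := by
  rcases p with o | _ | c <;> rcases s with _ | ⟨x, _ | ⟨y, s⟩⟩ <;> rfl

theorem Piece.actAt_over (p : Piece Unit α) (k : ℕ) (s : List α) :
    p.over.actAt k s = p.actAt k s := by
  induction k generalizing s with
  | zero => exact p.act_over s
  | succ k ih => rcases s with _ | ⟨x, s⟩ <;> simp [Piece.actAt, ih]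

theorem Word.run_over (w : Word Unit α) (s : List α) : run (Word.over w) s = run w s := by
  induction w generalizing s with
  | nil => rfl
  | cons e w ih =>
    obtain ⟨k, p⟩ := e
    simp only [over_cons, run, Piece.actAt_over]
    congr 1
    funext r
    exact ih r

theorem Word.length_of_run {w : Word κ α} {s r : List α} (h : run w s = some r) :
    r.length + 2 * deaths w = s.length + 2 * births w := by
  induction w generalizing s with
  | nil =>
    simp only [run, Option.some.injEq] at h
    simp [h, deaths, births]
  | cons e w ih =>
    obtain ⟨k, p⟩ := e
    simp only [run, Option.bind_eq_some_iff] at h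
    obtain ⟨_, h1, h2⟩ := h
    have := ih h2
    obtain ⟨a, t, t', -, rfl, rfl, h3⟩ := Piece.exists_of_actAt h1
    rw [deaths_cons, births_cons]
    rcases p with o | _ | c <;> rcases t with _ | ⟨x, _ | ⟨y, t⟩⟩ <;> simp [Piece.act] at h3 <;>
      first
      | (subst h3; simp at this ⊢; omega)
      | (obtain ⟨-, rfl⟩ := h3; simp at this ⊢; omega)

theorem Word.exists_of_closed {u w : Word κ α} {k : ℕ} {p : Piece κ α}
    (h : run (u ++ (k, p) :: w) [] = some []) :
    ∃ b t t', b.length = k ∧ run u [] = some (b ++ t) ∧ p.act t = some t' ∧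
      run w (b ++ t') = some [] := by
  obtain ⟨s, h1, h2⟩ := run_append_eq_some h
  simp only [run, Option.bind_eq_some_iff] at h2
  obtain ⟨_, h3, h4⟩ := h2
  obtain ⟨b, t, t', h5, rfl, rfl, h6⟩ := Piece.exists_of_actAt h3
  exact ⟨b, t, t', h5, h1, h6, h4⟩

theorem Word.exists_of_closed_pair {u w : Word κ α} {k j : ℕ} {p q : Piece κ α}
    (h : run (u ++ (k, p) :: (j, q) :: w) [] = some []) :
    ∃ b t t', b.length = k ∧ run u [] = some (b ++ t) ∧ p.act t = some t' ∧
      ∃ r, q.actAt j (b ++ t') = some r := by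
  obtain ⟨b, t, t', h1, h2, h3, h4⟩ := exists_of_closed h
  simp only [run, Option.bind_eq_some_iff] at h4
  exact ⟨b, t, t', h1, h2, h3, h4.imp fun _ h => h.1⟩

/-- Laurent polynomials without negative powers of `a`. -/
def genuinePolynomials : Subring Laurent2 := (Polynomial.toLaurent (R := ℤ[T;T⁻¹])).range

theorem aPow_natCast_mem (n : ℕ) : aPow n ∈ genuinePolynomials :=
  ⟨Polynomial.X ^ n, Polynomial.toLaurent_X_pow n⟩

theorem aPow_one_mem : aPow 1 ∈ genuinePolynomials := aPow_natCast_mem 1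

theorem zPow_mem (n : ℤ) : zPow n ∈ genuinePolynomials :=
  ⟨Polynomial.C (LaurentPolynomial.T n), Polynomial.toLaurent_C _⟩

/-- The right cusp of the circle supplies the `a` that clears `a⁻¹`. -/
theorem aPow_mul_circleValue_mem (o : α) :
    aPow 1 * IsSkeinInvariant.circleValue o ∈ genuinePolynomials := by
  have : aPow 1 * IsSkeinInvariant.circleValue o =
      (aPow 1 * aPow 1 - 1) * zPow (-1) + aPow 1 * if rev o = o then 1 else 0 := by
    have : aPow 1 * aPow (-1) = 1 := by rw [aPow_mul]; exact aPow_zero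
    unfold IsSkeinInvariant.circleValue
    linear_combination (-zPow (-1)) * this
  rw [this]
  refine add_mem (mul_mem (sub_mem (mul_mem aPow_one_mem aPow_one_mem) (one_mem _)) (zPow_mem _))
    (mul_mem aPow_one_mem ?_)
  split_ifs
  · exact one_mem _
  · exact zero_mem _

/-- The value on a front of a skein invariant has no negative powers of `a`; each right cusp
contributes a positive curl, hence a factor `a`. -/
def Word.Good (F : LinkDiagram α → Laurent2) (w : Word Unit α) : Prop :=
  aPow (deaths w) * val F (Word.over w) ∈ genuinePolynomials

/-- Thanks to the default value `0`, the induction never has to check that the words produced by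
smoothings fit together. -/
theorem Word.good_of_not_closed {F : LinkDiagram α → Laurent2} {w : Word Unit α}
    (h : run w [] ≠ some []) : Good F w := by
  rw [Good, val_of_not_closed (by rwa [run_over]), mul_zero]
  exact zero_mem _

/-- It is enough to consider closed words. -/
theorem Word.good_of_closed {F : LinkDiagram α → Laurent2} {w : Word Unit α}
    (h : run w [] = some [] → Good F w) : Good F w := by
  by_cases hw : run w [] = some []
  · exact h hw
  · exact good_of_not_closed hw

/-! ### Reductions of fronts that respect polynomiality -/

namespace IsSkeinInvariant

variable {F : LinkDiagram α → Laurent2} {u v : Word Unit α}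
  {k : ℕ} {o : α}

theorem good_nil (hF : IsSkeinInvariant F) : Good F [] := by
  simp [Good, Word.over, hF.empty, deaths, aPow_zero, one_mem]

theorem good_far (hF : IsSkeinInvariant F) (e f : Piece Unit α) (k m : ℕ) :
    Good F (u ++ (k, e) :: (k + e.outs + m, f) :: v) ↔
      Good F (u ++ (k + e.ins + m, f) :: (k, e) :: v) := by
  have := hF.val_far (u := u.over) (v := v.over) e.over f.over k m
  simp only [Piece.outs_over, Piece.ins_over] at this
  have hd : deaths (u ++ (k, e) :: (k + e.outs + m, f) :: v) =
      deaths (u ++ (k + e.ins + m, f) :: (k, e) :: v) := by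
    simp only [deaths_append, deaths_cons]
    omega
  rw [Good, Good, hd]
  simp only [over_append, over_cons, this]

theorem good_reidemeister3 (hF : IsSkeinInvariant F)
    (h : Good F (u ++ (k + 1, .cross ()) :: (k, .cross ()) ::
    (k + 1, .cross ()) :: v)) :
    Good F (u ++ (k, .cross ()) :: (k + 1, .cross ()) :: (k, .cross ()) :: v) := by
  refine good_of_closed fun hc => ?_
  obtain ⟨s, h1, h2⟩ := run_append_eq_some hc
  obtain ⟨_, h3, -⟩ := run_append_eq_some
    (u := [(k, .cross ()), (k + 1, .cross ()), (k, .cross ())]) h2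
  have := hF.val_move (u := u.over) (c := []) (v := v.over) (.reidemeister3 k true) (s := s)
    (by simpa [run_over] using h1) (by
      rw [show [(k, .cross true), (k + 1, .cross true), (k, .cross true)] =
        Word.over [(k, .cross ()), (k + 1, .cross ()), (k, (.cross () : Piece Unit α))] from rfl,
        run_over, h3]
      rfl)
  simp only [List.cons_append, List.nil_append] at this
  simpa only [Good, over_append, over_cons, Piece.over, this, deaths_append, deaths_cons] using h

/-- The zigzag contains a right cusp, so it contributes one more factor `a`; for this reason only
one direction holds. -/
theorem good_zigzag (hF : IsSkeinInvariant F)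
    (h : Good F (u ++ v)) : Good F (u ++ (k, .birth o) :: (k + 1, .death) :: v) := by
  refine good_of_closed fun hc => ?_
  obtain ⟨s, h1, h2⟩ := run_append_eq_some hc
  obtain ⟨_, h3, -⟩ := run_append_eq_some (u := [(k, .birth o), (k + 1, .death)]) h2
  have := hF.val_move (u := u.over) (c := []) (v := v.over) (.zigzag k o) (s := s)
    (by simpa [run_over] using h1) (by
      rw [show [(k, .birth o), (k + 1, .death)] =
        Word.over [(k, .birth o), (k + 1, (.death : Piece Unit α))] from rfl, run_over, h3]
      rfl)
  simp only [List.cons_append, List.nil_append] at this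
  simp only [Good, over_append, over_cons, Piece.over, this, deaths_append, deaths_cons] at h ⊢
  rw [show ((deaths u + (0 + (1 + deaths v)) : ℕ) : ℤ) = 1 + (deaths u + deaths v : ℕ) by
    push_cast; ring, ← aPow_mul, mul_assoc]
  exact mul_mem aPow_one_mem h

theorem good_zagzig (hF : IsSkeinInvariant F)
    (h : Good F (u ++ v)) : Good F (u ++ (k + 1, .birth o) :: (k, .death) :: v) := by
  refine good_of_closed fun hc => ?_
  obtain ⟨s, h1, h2⟩ := run_append_eq_some hc
  obtain ⟨_, h3, -⟩ := run_append_eq_some (u := [(k + 1, .birth o), (k, .death)]) h2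
  have := hF.val_move (u := u.over) (c := []) (v := v.over) (.zagzig k o) (s := s)
    (by simpa [run_over] using h1) (by
      rw [show [(k + 1, .birth o), (k, .death)] =
        Word.over [(k + 1, .birth o), (k, (.death : Piece Unit α))] from rfl, run_over, h3]
      rfl)
  simp only [List.cons_append, List.nil_append] at this
  simp only [Good, over_append, over_cons, Piece.over, this, deaths_append, deaths_cons] at h ⊢
  rw [show ((deaths u + (0 + (1 + deaths v)) : ℕ) : ℤ) = 1 + (deaths u + deaths v : ℕ) by
    push_cast; ring, ← aPow_mul, mul_assoc]
  exact mul_mem aPow_one_mem h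

theorem good_curl_death (hF : IsSkeinInvariant F) (h : Good F (u ++ (k, .death) :: v)) :
    Good F (u ++ (k, .cross ()) :: (k, .death) :: v) := by
  refine good_of_closed fun hc => ?_
  obtain ⟨b, t, t', rfl, h1, h2, r, h3⟩ := exists_of_closed_pair hc
  rcases t with _ | ⟨x, _ | ⟨y, t⟩⟩ <;> simp only [Piece.act, reduceCtorEq, Option.some.injEq] at h2
  subst h2
  obtain rfl : x = rev y := by
    by_contra hx
    simp [Piece.actAt_length, Piece.act, hx] at h3
  have := hF.val_curl_death (u := u.over) (v := v.over) (b := b) (x := rev y) (t := t)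
    (by rw [run_over, h1, rev_rev])
  simp only [Good, over_append, over_cons, Piece.over, this, deaths_append, deaths_cons] at h ⊢
  rw [mul_left_comm, zero_add]
  exact mul_mem aPow_one_mem h

theorem good_curl_birth (hF : IsSkeinInvariant F) (h : Good F (u ++ (k, .birth (rev o)) :: v)) :
    Good F (u ++ (k, .birth o) :: (k, .cross ()) :: v) := by
  refine good_of_closed fun hc => ?_
  obtain ⟨b, t, t', rfl, h1, -, -⟩ := exists_of_closed_pair hc
  have := hF.val_curl_birth (u := u.over) (v := v.over) (b := b) (o := o) (t := t)
    (by rw [run_over, h1])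
  simp only [Good, over_append, over_cons, Piece.over, this, deaths_append, deaths_cons] at h ⊢
  rw [mul_left_comm, zero_add]
  exact mul_mem aPow_one_mem h

theorem good_circle (hF : IsSkeinInvariant F)
    (h : Good F (u ++ v)) : Good F (u ++ (k, .birth o) :: (k, .death) :: v) := by
  refine good_of_closed fun hc => ?_
  obtain ⟨b, t, t', rfl, h1, -, -⟩ := exists_of_closed_pair hc
  have := hF.val_circle (u := u.over) (v := v.over) (b := b) (o := o) (t := t)
    (by rw [run_over, h1])
  simp only [Good, over_append, over_cons, Piece.over, this, deaths_append, deaths_cons] at h ⊢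
  rw [show ((deaths u + (0 + (1 + deaths v)) : ℕ) : ℤ) = 1 + (deaths u + deaths v : ℕ) by
    push_cast; ring, ← aPow_mul, mul_mul_mul_comm]
  exact mul_mem (aPow_mul_circleValue_mem o) h

theorem good_double_cross (hF : IsSkeinInvariant F)
    (h : Good F (u ++ v)) (h' : Good F (u ++ (k, .cross ()) :: v))
    (h'' : ∀ o, Good F (u ++ (k, .death) :: (k, .birth o) :: v)) :
    Good F (u ++ (k, .cross ()) :: (k, .cross ()) :: v) := by
  refine good_of_closed fun hc => ?_
  obtain ⟨b, t, t', rfl, h1, h2, -⟩ := exists_of_closed_pair hc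
  rcases t with _ | ⟨x, _ | ⟨y, t⟩⟩ <;> simp only [Piece.act, reduceCtorEq, Option.some.injEq] at h2
  have := hF.val_double_cross (u := u.over) (v := v.over) (b := b) (x := x) (y := y) (t := t)
    (by rw [run_over, h1])
  specialize h'' (rev y)
  simp only [Good, over_append, over_cons, Piece.over, this, deaths_append, deaths_cons,
    zero_add] at h h' h'' ⊢
  rw [mul_add, mul_left_comm _ (zPow 1), mul_sub, mul_ite, mul_ite, mul_zero]
  refine add_mem h (mul_mem (zPow_mem _) (sub_mem ?_ ?_))
  · split_ifs
    -- The `a` of the curl is exactly what the right cusp of the vertical splicing contributes to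
    -- `Good`.
    · rw [show ((deaths u + (1 + deaths v) : ℕ) : ℤ) = (deaths u + deaths v : ℕ) + 1 by
        push_cast; ring, ← aPow_mul, mul_assoc] at h''
      exact h''
    · exact zero_mem _
  · split_ifs
    · exact h'
    · exact zero_mem _

/-- A left cusp can pass a strand, up to fronts with fewer crossings. -/
theorem good_cusp_cross (hF : IsSkeinInvariant F) (h : Good F (u ++ (k + 1, .birth o) :: v))
    (h' : Good F (u ++ (k, .birth o) :: v)) :
    Good F (u ++ (k + 1, .birth o) :: (k, .cross ()) :: v) ↔
      Good F (u ++ (k, .birth o) :: (k + 1, .cross ()) :: v) := by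
  have key : ∀ (b : List α) (x : α) (t : List α), b.length = k → run u [] = some (b ++ x :: t) →
      (Good F (u ++ (k + 1, .birth o) :: (k, .cross ()) :: v) ↔
      Good F (u ++ (k, .birth o) :: (k + 1, .cross ()) :: v)) := by
    rintro b x t rfl hu
    have := hF.val_cusp_cross (u := u.over) (v := v.over) (b := b) (x := x) (o := o) (t := t)
      (by rw [run_over, hu])
    simp only [Good, over_append, over_cons, Piece.over, this, deaths_append, deaths_cons,
      zero_add] at h h' ⊢
    rw [mul_sub, mul_left_comm _ (zPow 1), mul_sub, mul_ite, mul_ite, mul_zero]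
    refine (fun hd => ⟨fun hg => by simpa using add_mem hg hd, fun hg => sub_mem hg hd⟩)
      (mul_mem (zPow_mem 1) (sub_mem ?_ ?_))
    · split_ifs
      · exact h
      · exact zero_mem _
    · split_ifs
      · exact h'
      · exact zero_mem _
  constructor
  · refine fun hg => good_of_closed fun hc => ?_
    obtain ⟨b, t, t', hb, h1, h2, r, h3⟩ := exists_of_closed_pair hc
    simp only [Piece.act, Option.some.injEq] at h2
    subst h2
    rcases t with _ | ⟨x, t⟩
    · simp [← hb, Piece.actAt_length_add, Piece.actAt, Piece.act] at h3
    · exact (key b x t hb h1).1 hg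
  · refine fun hg => good_of_closed fun hc => ?_
    obtain ⟨b, t, t', hb, h1, -⟩ := exists_of_closed_pair hc
    rcases List.eq_nil_or_concat' b with rfl | ⟨b, x, rfl⟩
    · simp at hb
    · exact (key b x t (by simpa using hb) (by simpa using h1)).2 hg

theorem good_cross_cross_death (hF : IsSkeinInvariant F) (h : Good F (u ++ (k + 1, .death) :: v)) :
    Good F (u ++ (k, .cross ()) :: (k + 1, .cross ()) :: (k, .death) :: v) := by
  refine good_of_closed fun hc => ?_
  obtain ⟨b, t, t', rfl, h1, h2, h3⟩ := exists_of_closed hc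
  rcases t with _ | ⟨x, _ | ⟨y, _ | ⟨z, t⟩⟩⟩ <;>
    simp only [Piece.act, reduceCtorEq, Option.some.injEq] at h2 <;> subst h2 <;>
    simp [run, Piece.actAt_length_add, Piece.actAt, Piece.act] at h3
  obtain rfl : z = rev y := by
    by_contra hx
    simp [Piece.actAt_length, Piece.act, hx] at h3
  have := hF.val_cross_cross_death (u := u.over) (v := v.over) (b := b) (o := x) (x := y) (t := t)
    (by rw [run_over, h1])
  simpa only [Good, over_append, over_cons, Piece.over, this, deaths_append, deaths_cons,
    zero_add] using h

end IsSkeinInvariant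

end

/-! ### Chains of crossings along one strand -/

noncomputable section

open Direction

variable {α : Type}

open Word

/-- The strand at height `k` crosses upward the `m` next strands. -/
def Word.rise (k m : ℕ) : Word Unit α := (List.range m).map fun i => (k + i, .cross ())

/-- The strand at height `k + m` crosses downward the `m` next strands. -/
def Word.fall (k m : ℕ) : Word Unit α := (rise k m).reverse

theorem Word.rise_zero (k : ℕ) : (rise k 0 : Word Unit α) = [] := rfl

theorem Word.rise_succ (k m : ℕ) :
    (rise k (m + 1) : Word Unit α) = rise k m ++ [(k + m, .cross ())] := by
  simp [rise, List.range_succ]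

theorem Word.rise_succ_left (k m : ℕ) :
    (rise k (m + 1) : Word Unit α) = (k, .cross ()) :: rise (k + 1) m := by
  simp [rise, List.range_succ_eq_map, add_assoc, add_comm 1]

theorem Word.fall_succ (k m : ℕ) :
    (fall k (m + 1) : Word Unit α) = (k + m, .cross ()) :: fall k m := by
  simp [fall, rise_succ]

theorem Word.fall_succ_right (k m : ℕ) :
    (fall k (m + 1) : Word Unit α) = fall (k + 1) m ++ [(k, .cross ())] := by
  simp [fall, rise_succ_left]

theorem Word.rise_add (k m n : ℕ) :
    (rise k (m + n) : Word Unit α) = rise k m ++ rise (k + m) n := by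
  induction n with
  | zero => simp [rise_zero]
  | succ n ih => rw [← add_assoc, rise_succ, ih, rise_succ, List.append_assoc, add_assoc]

theorem Word.crossings_rise (k m : ℕ) : crossings (rise k m : Word Unit α) = m := by
  induction m with
  | zero => rfl
  | succ m ih => simp [rise_succ, crossings_append, ih, crossings_cons, crossings_nil]

theorem Word.births_rise (k m : ℕ) : births (rise k m : Word Unit α) = 0 := by
  induction m with
  | zero => rfl
  | succ m ih => simp [rise_succ, births_append, ih, births_cons, births_nil]

theorem Word.deaths_rise (k m : ℕ) : deaths (rise k m : Word Unit α) = 0 := by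
  induction m with
  | zero => rfl
  | succ m ih => rw [rise_succ, deaths_append, ih]; rfl

theorem Word.crossings_fall (k m : ℕ) : crossings (fall k m : Word Unit α) = m := by
  induction m with
  | zero => rfl
  | succ m ih => rw [fall_succ, crossings_cons, ih, add_comm]

theorem Word.births_fall (k m : ℕ) : births (fall k m : Word Unit α) = 0 := by
  induction m with
  | zero => rfl
  | succ m ih => rw [fall_succ, births_cons, ih]

theorem Word.mem_rise {k m : ℕ} {e : ℕ × Piece Unit α} (h : e ∈ rise k m) :
    e.2 = .cross () ∧ e.1 < k + m := by
  obtain ⟨i, hi, rfl⟩ := List.mem_map.1 h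
  exact ⟨rfl, by simpa using hi⟩

theorem Word.mem_fall {k m : ℕ} {e : ℕ × Piece Unit α} (h : e ∈ fall k m) :
    e.2 = .cross () ∧ e.1 < k + m :=
  mem_rise (List.mem_reverse.1 h)

theorem Word.exists_last_birth (w : Word Unit α) (h : births w ≠ 0) :
    ∃ u k o v, w = u ++ (k, .birth o) :: v ∧ births v = 0 := by
  induction w with
  | nil => exact absurd rfl h
  | cons e w ih =>
    by_cases hw : births w = 0
    · obtain ⟨k, _ | _ | _⟩ := e
      · exact ⟨[], k, _, w, rfl, hw⟩
      all_goals exact absurd (by simp [births_cons, hw]) h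
    · obtain ⟨u, k, o, v, rfl, hv⟩ := ih hw
      exact ⟨e :: u, k, o, v, rfl, hv⟩

variable [DecidableEq α] [Direction α]

/-! ### Elimination of the last left cusp -/

namespace IsSkeinInvariant

variable {F : LinkDiagram α → Laurent2}

/-- Crossings preserve the number of strands, so a piece lying above all of them keeps its height.
-/
theorem good_comm_above (hF : IsSkeinInvariant F) {y u v : Word Unit α} {j : ℕ}
    (hy : ∀ e ∈ y, e.2 = .cross () ∧ e.1 + 2 ≤ j) (p : Piece Unit α) :
    Good F (u ++ (y ++ (j, p) :: v)) ↔ Good F (u ++ (j, p) :: (y ++ v)) := by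
  induction y generalizing u with
  | nil => rfl
  | cons e y ih =>
    obtain ⟨i, q⟩ := e
    obtain ⟨rfl, hi⟩ : q = .cross () ∧ i + 2 ≤ j := hy (i, q) (by simp)
    have h1 := ih (u := u ++ [(i, .cross ())]) fun e he => hy e (by simp [he])
    have h2 := hF.good_far (u := u) (v := y ++ v) (.cross ()) p i (j - i - 2)
    simp only [Piece.outs, Piece.ins, show i + 2 + (j - i - 2) = j by omega] at h2
    simp only [List.append_assoc, List.cons_append, List.nil_append] at h1 ⊢
    rw [h1, h2]

theorem good_comm_below (hF : IsSkeinInvariant F)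
    {u v : Word Unit α} (p : Piece Unit α) (j i m : ℕ) :
    Good F (u ++ (rise (j + p.ins + i) m ++ (j, p) :: v)) ↔
      Good F (u ++ (j, p) :: (rise (j + p.outs + i) m ++ v)) := by
  induction m generalizing u i with
  | zero => rfl
  | succ m ih =>
    have h1 := ih (u := u ++ [(j + p.ins + i, .cross ())]) (i + 1)
    have h2 := hF.good_far (u := u) (v := rise (j + p.outs + (i + 1)) m ++ v) p (.cross ()) j i
    rw [rise_succ_left, rise_succ_left]
    simp only [List.append_assoc, List.cons_append, List.nil_append, ← add_assoc] at h1 h2 ⊢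
    rw [h1, h2]

/-- The cusp is pushed through the `m` strands one at a time; each correction has fewer crossings
and is covered by `ih`. In the rising form the last crossing of the chain involves the upper branch,
in the falling form the lower branch, so either branch can be made to face the next piece. -/
theorem good_rise_iff_fall (hF : IsSkeinInvariant F)
    {n : ℕ} (ih : ∀ w : Word Unit α, crossings w < n → Good F w)
    {u v : Word Unit α} {k m : ℕ} {o : α} (hn : crossings u + m + crossings v ≤ n) :
    Good F (u ++ (k, .birth o) :: (rise (k + 1) m ++ v)) ↔
      Good F (u ++ (k + m, .birth o) :: (fall k m ++ v)) := by
  induction m generalizing v with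
  | zero => rfl
  | succ m ihm =>
    have h1 := ihm (v := (k + 1 + m, .cross ()) :: v) (by rw [crossings_cons]; simp only; omega)
    have h2 := hF.good_comm_above (u := u ++ [(k + m, .birth o)]) (v := v) (y := fall k m)
      (j := k + 1 + m) (fun e he => ⟨(mem_fall he).1, by have := (mem_fall he).2; omega⟩) (.cross ())
    have h3 := hF.good_cusp_cross (u := u) (v := fall k m ++ v) (k := k + m) (o := o)
      (ih _ (by
        simp only [crossings_append, crossings_cons, crossings_fall]
        omega))
      (ih _ (by
        simp only [crossings_append, crossings_cons, crossings_fall]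
        omega))
    rw [rise_succ, fall_succ]
    simp only [List.append_assoc, List.cons_append, List.nil_append,
      show k + 1 + m = k + m + 1 by omega, ← add_assoc] at h1 h2 h3 ⊢
    rw [h1, h2, h3]

/-- Induction on what follows the cusp and its chain of `m` crossings. The next piece passes to the
left into `u`, lengthens the chain, or exposes a reduction to fewer crossings or fewer left cusps.
The bound counts `m` together with the crossings of `u` and `v`, since pieces are only transferred
between the three. -/
theorem good_of_last_birth (hF : IsSkeinInvariant F)
    {n d : ℕ} (ihc : ∀ w : Word Unit α, crossings w < n → Good F w)
    (ihb : ∀ w : Word Unit α, crossings w ≤ n → births w < d → Good F w) (v : Word Unit α)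
    (hv : births v = 0) (u : Word Unit α) (k m : ℕ) (o : α)
    (hn : crossings u + m + crossings v ≤ n) (hd : births u + 1 ≤ d) :
    Good F (u ++ (k, .birth o) :: (rise (k + 1) m ++ v)) := by
  induction v generalizing u k m with
  | nil =>
    -- Without a right cusp after it, the left cusp leaves open strands.
    refine good_of_not_closed fun hc => ?_
    obtain ⟨s, -, h⟩ := run_append_eq_some hc
    have := length_of_run h
    simp [deaths_cons, deaths_rise, births_cons] at this
    omega
  | cons e v ih =>
    obtain ⟨j, p⟩ := e
    have hp : p = .cross () ∨ p = .death := by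
      rcases p with _ | _ | _
      · simp [births_cons] at hv
      · exact Or.inr rfl
      · exact Or.inl rfl
    have hins : p.ins = 2 := by rcases hp with rfl | rfl <;> rfl
    have hv' : births v = 0 := by rw [births_cons] at hv; omega
    have hb0 : births [(j, p)] = 0 := by rw [births_cons] at hv; rw [births_cons, births_nil]; omega
    have hn' : crossings u + m + crossings [(j, p)] + crossings v ≤ n := by
      rw [← List.singleton_append, crossings_append] at hn
      omega
    rcases lt_or_ge (j + 1) k with h1 | h1
    · -- the next piece is below the cusp
      obtain ⟨i, rfl⟩ := Nat.exists_eq_add_of_le (show j + 2 ≤ k from h1)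
      have e1 := hF.good_comm_below (u := u ++ [(j + 2 + i, .birth o)]) (v := v) p j (i + 1) m
      have e2 := hF.good_far (u := u) (v := rise (j + p.outs + i + 1) m ++ v) p (.birth o) j i
      have e3 := ih hv' (u ++ [(j, p)]) (j + p.outs + i) m
        (by rw [crossings_append]; omega) (by rw [births_append]; omega)
      simp only [List.append_assoc, List.cons_append, List.nil_append, hins, ← add_assoc]
        at e1 e2 e3 ⊢
      rw [e1, ← e2]
      exact e3
    rcases eq_or_lt_of_le h1 with h2 | h2
    · -- the lower branch meets the strand below it
      subst h2
      rcases hp with rfl | rfl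
      -- In the falling form the lower branch continues downward through this crossing, so the chain
      -- grows at its lower end; it is then turned back into a rising one.
      · rw [hF.good_rise_iff_fall ihc hn]
        have e1 := (hF.good_rise_iff_fall ihc (u := u) (k := j) (m := m + 1) (v := v) (o := o) (by
          simp only [crossings_cons] at hn; omega)).1 (ih hv' u j (m + 1)
            (by simp only [crossings_cons] at hn; omega) hd)
        rw [fall_succ_right] at e1
        simp only [List.append_assoc, List.cons_append, List.nil_append,
          show j + (m + 1) = j + 1 + m by omega] at e1
        exact e1
      · have e1 := hF.good_comm_below (u := u ++ [(j + 1, .birth o)]) (v := v) .death j 0 m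
        have e2 := hF.good_zagzig (u := u) (v := rise j m ++ v) (k := j) (o := o)
          (ihb _ (by simp only [crossings_append, crossings_rise, crossings_cons] at hn ⊢; omega)
            (by simp only [births_append, births_rise]; omega))
        simp only [List.append_assoc, List.cons_append, List.nil_append, Piece.ins, Piece.outs,
          add_zero, add_assoc, Nat.reduceAdd] at e1 ⊢
        rwa [e1]
    rcases eq_or_lt_of_le (show k ≤ j by omega) with h3 | h3
    · -- the lower branch meets the strand above it
      subst h3
      rcases m with _ | m
      · rw [rise_zero, List.nil_append]
        rcases hp with rfl | rfl
        · refine hF.good_curl_birth (ihc _ ?_)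
          simp only [crossings_append, crossings_cons] at hn ⊢
          omega
        · refine hF.good_circle (ihb _ ?_ ?_)
          · simp only [crossings_append, crossings_cons] at hn ⊢
            omega
          · rw [births_append]
            omega
      -- The last crossing of the falling chain is at height `k`, directly before the next piece:
      -- together they form a double crossing or a curl.
      · rw [hF.good_rise_iff_fall ihc hn, fall_succ_right]
        have key : ∀ w : Word Unit α, u ++ (k + (m + 1), .birth o) ::
            (fall (k + 1) m ++ [(k, .cross ())] ++ w) =
            (u ++ (k + (m + 1), .birth o) :: fall (k + 1) m) ++ (k, .cross ()) :: w := by simp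
        rw [key]
        rcases hp with rfl | rfl
        · refine hF.good_double_cross (ihc _ ?_) (ihc _ ?_) fun o' => ihc _ ?_ <;>
          · simp only [crossings_append, crossings_cons, crossings_fall] at hn ⊢
            omega
        · refine hF.good_curl_death (ihc _ ?_)
          simp only [crossings_append, crossings_cons, crossings_fall] at hn ⊢
          omega
    rcases lt_or_ge j (k + m) with h4 | h4
    · -- the next piece is between the branches
      obtain ⟨i, rfl⟩ := Nat.exists_eq_add_of_le (show k + 1 ≤ j from h3)
      obtain ⟨r, rfl⟩ := Nat.exists_eq_add_of_le (show i + 2 ≤ m by omega)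
      have hr : (rise (k + 1) (i + 2 + r) : Word Unit α) = rise (k + 1) i ++
          (k + 1 + i, .cross ()) :: (k + 1 + i + 1, .cross ()) :: rise (k + 1 + i + 2) r := by
        rw [rise_add, add_assoc, rise_add, rise_succ, rise_succ, rise_zero]
        simp [add_assoc]
      have e1 := hF.good_comm_below (u := u ++ (k, .birth o) :: (rise (k + 1) i ++
        [(k + 1 + i, .cross ()), (k + 1 + i + 1, .cross ())])) (v := v) p (k + 1 + i) 0 r
      rw [hr]
      simp only [List.append_assoc, List.cons_append, List.nil_append, hins, add_zero] at e1 ⊢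
      rw [e1]
      rcases hp with rfl | rfl
      -- The third Reidemeister move carries the crossing to the left of the upper branch, one level
      -- higher; there it commutes with the rest of the chain and with the cusp.
      · have e2 := hF.good_reidemeister3 (u := u ++ (k, .birth o) :: rise (k + 1) i)
          (v := rise (k + 1 + i + 2) r ++ v) (k := k + 1 + i)
        have e3 := hF.good_comm_above (u := u ++ [(k, .birth o)])
          (v := (k + 1 + i, .cross ()) :: (k + 1 + i + 1, .cross ()) ::
            (rise (k + 1 + i + 2) r ++ v)) (y := rise (k + 1) i) (j := k + 1 + i + 1)
          (fun e he => ⟨(mem_rise he).1, by have := (mem_rise he).2; omega⟩) (.cross ())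
        have e4 := hF.good_far (u := u) (v := rise (k + 1) (i + 2 + r) ++ v) (.birth o)
          (.cross ()) k i
        have e5 := ih hv' (u ++ [(k + i, .cross ())]) k (i + 2 + r)
          (by
            simp only [crossings_append, crossings_cons, crossings_nil] at hn ⊢
            omega)
          (by
            simp only [births_append, births_cons, births_nil]
            omega)
        rw [hr] at e4 e5
        simp only [List.append_assoc, List.cons_append, List.nil_append, Piece.outs, Piece.ins,
          show k + 2 + i = k + 1 + i + 1 by omega, add_zero] at e2 e3 e4 e5 ⊢
        exact e2 (e3.2 (e4.2 e5))
      · have e2 := hF.good_cross_cross_death (u := u ++ (k, .birth o) :: rise (k + 1) i)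
          (v := rise (k + 1 + i) r ++ v) (k := k + 1 + i) (ihc _ (by
            simp only [crossings_append, crossings_cons, crossings_rise] at hn ⊢
            omega))
        simpa only [List.append_assoc, List.cons_append, List.nil_append, Piece.outs,
          add_zero] using e2
    rcases eq_or_lt_of_le h4 with h5 | h5
    · -- the upper branch meets the strand below it
      subst h5
      obtain ⟨m, rfl⟩ := Nat.exists_eq_succ_of_ne_zero (show m ≠ 0 by omega)
      have key : ∀ w : Word Unit α, u ++ (k, .birth o) :: (rise (k + 1) (m + 1) ++ w) =
          (u ++ (k, .birth o) :: rise (k + 1) m) ++ (k + (m + 1), .cross ()) :: w := by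
        simp [rise_succ, add_assoc, add_comm 1]
      rw [Nat.succ_eq_add_one, key]
      rcases hp with rfl | rfl
      · refine hF.good_double_cross (ihc _ ?_) (ihc _ ?_) fun o' => ihc _ ?_ <;>
        · simp only [crossings_append, crossings_cons, crossings_rise] at hn ⊢
          omega
      · refine hF.good_curl_death (ihc _ ?_)
        simp only [crossings_append, crossings_cons, crossings_rise] at hn ⊢
        omega
    rcases eq_or_lt_of_le (show k + m + 1 ≤ j from h5) with h6 | h6
    · -- the upper branch meets the strand above it
      subst h6
      rcases hp with rfl | rfl
      · have e1 := ih hv' u k (m + 1) (by simp only [crossings_cons] at hn; omega) hd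
        rw [rise_succ] at e1
        simpa only [List.append_assoc, List.cons_append, List.nil_append,
          show k + 1 + m = k + m + 1 by omega] using e1
      -- In the falling form the upper branch runs straight to the right cusp, which leaves a
      -- zigzag.
      · rw [hF.good_rise_iff_fall ihc hn]
        have e1 := hF.good_comm_above (u := u ++ [(k + m, .birth o)])
          (v := v) (y := fall k m) (j := k + m + 1)
          (fun e he => ⟨(mem_fall he).1, by have := (mem_fall he).2; omega⟩) .death
        have e2 := hF.good_zigzag (u := u) (v := fall k m ++ v) (k := k + m) (o := o)
          (ihb _ (by simp only [crossings_append, crossings_fall, crossings_cons] at hn ⊢; omega)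
            (by simp only [births_append, births_fall]; omega))
        simp only [List.append_assoc, List.cons_append, List.nil_append] at e1
        rwa [e1]
    · -- the next piece is above the cusp
      obtain ⟨i, rfl⟩ := Nat.exists_eq_add_of_le (show k + m + 2 ≤ j from h6)
      have e1 := hF.good_comm_above (u := u ++ [(k, .birth o)])
        (v := v) (y := rise (k + 1) m) (j := k + m + 2 + i)
        (fun e he => ⟨(mem_rise he).1, by have := (mem_rise he).2; omega⟩) p
      have e2 := hF.good_far (u := u) (v := rise (k + 1) m ++ v) (.birth o) p k (m + i)
      have e3 := ih hv' (u ++ [(k + (m + i), p)]) k m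
        (by
          have : crossings [(k + (m + i), p)] = crossings [(k + m + 2 + i, p)] := by
            simp only [crossings_cons]
          rw [crossings_append]; omega)
        (by
          have : births [(k + (m + i), p)] = births [(k + m + 2 + i, p)] := by
            simp only [births_cons]
          rw [births_append]; omega)
      simp only [List.append_assoc, List.cons_append, List.nil_append, Piece.outs, Piece.ins,
        show k + 2 + (m + i) = k + m + 2 + i by omega, add_zero] at e1 e2 e3 ⊢
      rw [e1, e2]
      exact e3

/-- Skein invariants of fronts have no negative powers of `a`. -/
theorem good (hF : IsSkeinInvariant F) (w : Word Unit α) : Good F w := by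
  -- The order is lexicographic because a vertical splicing removes a crossing but adds a left cusp.
  have main : ∀ n d (w : Word Unit α), crossings w ≤ n → births w ≤ d → Good F w := by
    intro n
    induction n using Nat.strong_induction_on with
    | _ n ihn =>
      intro d
      induction d with
      | zero =>
        intro w _ hd
        refine good_of_closed fun hc => ?_
        have h0 : deaths w = 0 := by
          have := length_of_run hc
          simp only [List.length_nil] at this
          omega
        -- The first piece of a closed word finds no strands, so it must be a left cusp.
        rcases w with _ | ⟨⟨k, p⟩, w⟩
        · exact hF.good_nil
        · obtain ⟨b, t, t', -, h1, h2, -⟩ := exists_of_closed (u := []) hc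
          obtain ⟨rfl, rfl⟩ := List.append_eq_nil_iff.1 (Option.some.inj h1).symm
          rcases p with o | _ | _ <;> simp [Piece.act] at h2
          simp [births_cons] at hd
      | succ d ihd =>
        intro w hn hd
        by_cases h0 : births w = 0
        · exact ihd w hn (by omega)
        obtain ⟨u, k, o, v, rfl, hv⟩ := exists_last_birth w h0
        simp only [crossings_append, crossings_cons, births_append, births_cons] at hn hd
        exact hF.good_of_last_birth (n := n) (d := d + 1)
          (fun w' h' => ihn _ h' _ w' le_rfl le_rfl)
          (fun w' h' h'' => ihd w' h' (by omega)) v hv u k 0 o (by omega) (by omega)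
  exact main _ _ w le_rfl le_rfl

end IsSkeinInvariant

end

noncomputable section

open Direction

variable {α : Type} [DecidableEq α] [Direction α]

open Word

/-! ### Morsifications -/

/-- The curls are removed from left to right by `val_curl_death`; `u` is the part already rounded.
-/
theorem IsSkeinInvariant.val_morsify {F : LinkDiagram α → Laurent2} (hF : IsSkeinInvariant F)
    {u : Word Bool α} {w : Word Unit α} {s r : List α} (hu : run u [] = some s)
    (hw : run w s = some r) :
    val F (u ++ Word.morsify w) = aPow (deaths w) * val F (u ++ Word.over w) := by
  induction w generalizing u s with
  | nil => simp [Word.morsify, Word.over, deaths, aPow_zero]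
  | cons e w ih =>
    obtain ⟨k, p⟩ := e
    simp only [run, Option.bind_eq_some_iff] at hw
    obtain ⟨s', h1, h2⟩ := hw
    have hu' : run (u ++ [(k, p.over)]) [] = some s' := by
      rw [run_append, hu, Option.bind_some, run, Piece.actAt_over, h1]
      rfl
    have key := ih hu' h2
    rw [List.append_assoc, List.append_assoc, List.singleton_append, List.singleton_append] at key
    rw [show Word.morsify ((k, p) :: w) = p.morsify k ++ Word.morsify w from rfl, over_cons,
      deaths_cons]
    rcases p with o | _ | c
    · simpa [Piece.morsify, Piece.over] using key
    · obtain ⟨b, t, t', rfl, rfl, rfl, h3⟩ := Piece.exists_of_actAt h1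
      rcases t with _ | ⟨x, _ | ⟨y, t⟩⟩ <;> simp [Piece.act] at h3
      obtain ⟨rfl, rfl⟩ := h3
      have e := hF.val_curl_death (v := Word.morsify w) hu
      simp only [Piece.morsify, Piece.over, List.cons_append, List.nil_append] at key e ⊢
      rw [e, key, ← mul_assoc, aPow_mul]
      push_cast
      rfl
    · simpa [Piece.morsify, Piece.over] using key

theorem IsSkeinInvariant.isGenuinePolynomial {F : LinkDiagram α → Laurent2}
    (hF : IsSkeinInvariant F) (l : Front α) : IsGenuinePolynomial (F l.morsify) := by
  have h := hF.val_morsify (u := []) rfl l.2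
  rw [List.nil_append, val_of_closed (Word.morsify_run l.1 [] [] l.2)] at h
  exact h ▸ hF.good l.1

theorem isGenuinePolynomial_zero {A : Type} [Semiring A] :
    IsGenuinePolynomial (0 : A[T;T⁻¹]) := ⟨0, map_zero _⟩

/-- The values of `R` on oriented fronts have no negative powers of `a`.  The only property of `R`
that is used is that it satisfies its defining relations. -/
theorem isGenuinePolynomial_homflyR (l : Front Bool) : IsGenuinePolynomial (homflyR l.morsify) := by
  unfold homflyR
  -- Existence of the invariant is not needed: the default value `0` is a polynomial too.
  split_ifs with h
  · exact h.choose_spec.isSkeinInvariant.isGenuinePolynomial l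
  · exact isGenuinePolynomial_zero

/-- The values of `D` on unoriented fronts have no negative powers of `a`.  The only property of `D`
that is used is that it satisfies its defining relations. -/
theorem isGenuinePolynomial_kauffmanD (l : Front Unit) :
    IsGenuinePolynomial (kauffmanD l.morsify) := by
  unfold kauffmanD
  split_ifs with h
  · exact h.choose_spec.isSkeinInvariant.isGenuinePolynomial l
  · exact isGenuinePolynomial_zero

/-! ### States -/

theorem IsGenuinePolynomial.mul {A : Type} [Semiring A] {f g : A[T;T⁻¹]}
    (hf : IsGenuinePolynomial f) (hg : IsGenuinePolynomial g) : IsGenuinePolynomial (f * g) := by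
  obtain ⟨p, rfl⟩ := hf
  obtain ⟨q, rfl⟩ := hg
  exact ⟨p * q, map_mul _ _ _⟩

theorem isGenuinePolynomial_C {A : Type} [Semiring A] (r : A) :
    IsGenuinePolynomial (LaurentPolynomial.C r) := ⟨Polynomial.C r, Polynomial.toLaurent_C r⟩

theorem isGenuinePolynomial_T {A : Type} [Semiring A] (n : ℕ) :
    IsGenuinePolynomial (LaurentPolynomial.T n : A[T;T⁻¹]) :=
  ⟨Polynomial.X ^ n, Polynomial.toLaurent_X_pow n⟩

/-- The substitution fixes `a`, so on polynomials it acts coefficientwise; it suffices to compare on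
constants and on the variable. -/
theorem IsGenuinePolynomial.subst {f : Laurent2} (hf : IsGenuinePolynomial f) :
    IsGenuinePolynomial (Laurent2.subst f) := by
  obtain ⟨p, rfl⟩ := hf
  refine ⟨p.map substZ, ?_⟩
  have : (Polynomial.toLaurent).comp (Polynomial.mapRingHom substZ) =
      Laurent2.subst.comp Polynomial.toLaurent := by
    refine Polynomial.ringHom_ext (fun r => ?_) ?_
    · simp [Laurent2.subst]
    · simp only [RingHom.comp_apply, Polynomial.coe_mapRingHom, Polynomial.map_X,
        Polynomial.toLaurent_X, Laurent2.subst, LaurentPolynomial.eval₂_T, zpow_one]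
  exact congrArg (fun φ => φ p) this

/-- Every vertical splicing with nonzero weight adds two cusps which compensate its factor
`a ^ (-2)`. -/
theorem isGenuinePolynomial_cuspCount_mul_weightProd (w : List (ℕ × StatePiece)) (s : List Bool) :
    IsGenuinePolynomial ((LaurentPolynomial.T
      (Word.cuspCount (w.flatMap fun e => e.2.target e.1) s : ℕ) : (RatFunc ℚ)[T;T⁻¹]) *
        weightProd w s) := by
  induction w generalizing s with
  | nil => simpa [Word.cuspCount, weightProd] using isGenuinePolynomial_C (1 : RatFunc ℚ)
  | cons e w ih =>
    have kept : ∀ (n : ℕ) (s' : List Bool), IsGenuinePolynomial ((LaurentPolynomial.T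
        ((n + Word.cuspCount (w.flatMap fun e => e.2.target e.1) s' : ℕ) : ℤ) :
          (RatFunc ℚ)[T;T⁻¹]) * weightProd w s') := fun n s' => by
      rw [Nat.cast_add, LaurentPolynomial.T_add, mul_assoc]
      exact (isGenuinePolynomial_T n).mul (ih s')
    have getD_run : ∀ (k : ℕ) (p : Piece Unit Bool),
        (run [(k, p)] s).getD [] = (p.actAt k s).getD [] := fun k p => by
      simp [run]
    obtain ⟨k, o | _ | _ | _ | o⟩ := e
    · simp only [List.flatMap_cons, StatePiece.target, List.cons_append, List.nil_append,
        Word.cuspCount, weightProd, StatePiece.weight, one_mul, getD_run]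
      exact kept _ _
    · simp only [List.flatMap_cons, StatePiece.target, List.cons_append, List.nil_append,
        Word.cuspCount, weightProd, StatePiece.weight, one_mul, getD_run]
      exact kept _ _
    · simp only [List.flatMap_cons, StatePiece.target, List.cons_append, List.nil_append,
        Word.cuspCount, weightProd, StatePiece.weight, one_mul, getD_run]
      exact kept _ _
    · simp only [List.flatMap_cons, StatePiece.target, List.nil_append, weightProd, run,
        Option.getD_some]
      rw [mul_left_comm]
      refine IsGenuinePolynomial.mul ?_ (ih s)
      unfold StatePiece.weight
      split <;> first | exact isGenuinePolynomial_zero | exact isGenuinePolynomial_C _ | simp_all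
    · by_cases h : o = false ∧ ∃ t, s.drop k = false :: true :: t
      · obtain ⟨rfl, t, ht⟩ := h
        obtain ⟨b, rfl, rfl⟩ : ∃ b : List Bool, s = b ++ false :: true :: t ∧ k = b.length := by
          refine ⟨s.take k, by rw [← ht, List.take_append_drop], ?_⟩
          have := congrArg List.length ht
          simp at this ⊢
          omega
        simp only [List.flatMap_cons, StatePiece.target, List.cons_append, List.nil_append,
          Word.cuspCount, weightProd, ht, StatePiece.weight, run, Piece.actAt_length, Piece.act,
          rev, Bool.not_false, if_true, Option.map_some, Option.getD_some, Option.bind_some]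
        -- The two units in the exponent are the new right cusp and the new left cusp: the lower
        -- branch runs leftward at both, so both are counted and cancel `a ^ (-2)`.
        have : ∀ (n : ℕ) (f : (RatFunc ℚ)[T;T⁻¹]), (LaurentPolynomial.T
            ((1 + (1 + n) : ℕ) : ℤ) : (RatFunc ℚ)[T;T⁻¹]) *
            (LaurentPolynomial.C (tVar * (tVar - tVar⁻¹)) * LaurentPolynomial.T (-2) * f) =
            LaurentPolynomial.C (tVar * (tVar - tVar⁻¹)) * (LaurentPolynomial.T n * f) := by
          intro n f
          rw [show ((n : ℕ) : ℤ) = ((1 + (1 + n) : ℕ) : ℤ) + (-2) by push_cast; ring,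
            LaurentPolynomial.T_add]
          ring
        rw [this]
        exact (isGenuinePolynomial_C _).mul (ih _)
      · have : StatePiece.weight (.vertical o) (s.drop k) = 0 := by
          unfold StatePiece.weight
          split <;> simp_all
        rw [weightProd, this, zero_mul, mul_zero]
        exact isGenuinePolynomial_zero

theorem State.isGenuinePolynomial_contribution {l : Front Unit} (σ : State l) :
    IsGenuinePolynomial σ.contribution := by
  have h := (((isGenuinePolynomial_C (tVar⁻¹ ^ Word.cuspCount σ.front.1 [])).mul
    (isGenuinePolynomial_cuspCount_mul_weightProd σ.pieces []))).mul
      (isGenuinePolynomial_homflyR σ.front).subst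
  convert h using 1
  rw [State.contribution, mul_pow, LaurentPolynomial.T_pow, mul_one, map_pow, mul_assoc (_ ^ _)]
  rfl

/-! ### The Bennequin invariant -/

theorem Word.forget_morsify {α : Type} (w : Word Unit α) :
    (Word.morsify w).forget = Word.morsify w.forget := by
  induction w with
  | nil => rfl
  | cons e w ih =>
    obtain ⟨k, o | _ | c⟩ := e <;>
      simpa [Word.morsify, Word.forget, Piece.morsify, Piece.forget] using ih

theorem Front.forget_morsify (l : Front α) :
    ClosedWord.forget l.morsify = Front.morsify (ClosedWord.forget l) :=
  Subtype.ext (Word.forget_morsify l.1)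

/-- Multiplication by `T n` shifts all exponents by `n`; for `f = 0` the least exponent is `⊤`. -/
theorem le_leastExponent_T_mul {A : Type} [Semiring A] {f : A[T;T⁻¹]}
    (hf : IsGenuinePolynomial f) (n : ℤ) :
    (n : WithTop ℤ) ≤ leastExponent (LaurentPolynomial.T n * f) := by
  obtain ⟨p, rfl⟩ := hf
  refine Finset.le_min fun i hi => WithTop.coe_le_coe.2 ?_
  rw [Finsupp.mem_support_iff, LaurentPolynomial.T,
    AddMonoidAlgebra.coeff_single_mul_eq_mul_coeff (m₂ := i - n) (by intros; omega), one_mul,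
    ← Finsupp.mem_support_iff, LaurentPolynomial.support_coeff_toLaurent] at hi
  obtain ⟨j, -, hj⟩ := Finset.mem_map.1 hi
  have : (j : ℤ) = i - n := hj
  omega

end

theorem mainTheorem2 (l : Front Bool) :
    (∀ σ : State l.forget, IsGenuinePolynomial σ.contribution) ∧
      IsGenuinePolynomial (kauffmanD (Front.morsify l.forget)) ∧
      (tb l : WithTop ℤ) ≤ eY l := by
  refine ⟨State.isGenuinePolynomial_contribution, isGenuinePolynomial_kauffmanD _, ?_⟩
  rw [eY, kauffmanY, Front.forget_morsify]
  -- The normalising exponent `-writhe` of `Y` is `tb l` by definition.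
  exact le_leastExponent_T_mul (isGenuinePolynomial_kauffmanD _) (tb l)
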